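/- For positive integers $s,n$ let $N_{s,n}=n(n+1)s/2$ and define the integers $t_{j,s,n}$ by $$\prod_{j=1}^{n}(1-q^j)^s=\sum_{j=0}^{N_{s,n}}t_{j,s,n}\,q^j ,\qquad \mathcal{M}_{n,s}:=\max_{0\le j\le N_{s,n}}|t_{j,s,n}| .$$ The function $w\mapsto w^{-1}\int_0^w\log\sin(\pi t)\,dt$ attains a maximum on the open interval $\frac12<w<1$, and the constant $$K=\log 2+\max_{1/2<w<1}\left(w^{-1}\int_0^w\log\sin(\pi t)\,dt\right)$$ satisfies $0.19861<K<0.19862$. For every fixed integer $s\ge 1$ and all sufficiently large $n$, $$\mathcal{M}_{n,s}=e^{sKn+O(\log n)}\qquad(n\to\infty),$$ where the threshold for $n$ and the implied constant may depend on $s$. -/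

import Mathlib

open Polynomial

/-- The polynomial `T_{s,n}(q) = ∏_{j=1}^n (1 - q^j)^s`, with integer coefficients. -/
noncomputable def truncProd (s n : ℕ) : ℤ[X] :=
  ∏ j ∈ Finset.Icc 1 n, (1 - X ^ j) ^ s

/-- The degree `N_{s,n} = n (n + 1) s / 2` of `T_{s,n}` (the division is exact). -/
def truncDeg (s n : ℕ) : ℕ := n * (n + 1) * s / 2

/-- The coefficient `t_{j,s,n}` of `q^j` in `T_{s,n}(q)`. -/
noncomputable def truncCoeff (j s n : ℕ) : ℤ := (truncProd s n).coeff j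

/-- `𝓜_{n,s}`, the maximum of `|t_{j,s,n}|` over `0 ≤ j ≤ N_{s,n}`. -/
noncomputable def maxCoeff (n s : ℕ) : ℤ :=
  (Finset.range (truncDeg s n + 1)).sup' Finset.nonempty_range_add_one
    (fun j => |truncCoeff j s n|)

/-- The function `w ↦ w⁻¹ ∫_0^w log sin(πt) dt`. -/
noncomputable def meanLogSin (w : ℝ) : ℝ :=
  w⁻¹ * ∫ t in (0 : ℝ)..w, Real.log (Real.sin (Real.pi * t))

/-! By Parseval the coefficients are at most the sup of `|T|` on the unit circle, and by the
triangle inequality that sup is at most (degree + 1) times the largest coefficient. A polynomial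
factor only costs `O(log n)` in the exponent, so it suffices that the Sudler product `∏ |1 - e(jθ)|`
has supremum `e^{Kn + O(log n)}` over `θ`.

Lower bound (`exp_le_prod`): at `θ = w/n`, with `w` the maximiser, the log of the product is a
Riemann sum for `(n/w) ∫_0^w log(2 sin πt) dt = Kn`. The integrand is unimodal, so the loss is
bounded.

Upper bound (`exists_prod_le`): replace `|1 - z|` by `|1 - rz|`, at a cost of `n(1 - r)` in the
exponent. The kernel `log |1 - r e(t)|` is smooth, with variation `O(log(2/(1 - r)))` per period,
and its integral over `[0, w]` is at most `Kw`. If `θ` is within `1/n` of an integer, `r = 1 - 1/n`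
gives `Kn + O(log n)`. Otherwise a fixed `r` close to 1 is enough, because half of the exponent is
saved. In the Fourier expansion only frequencies `m` with `mθ` near an integer matter, and these are
multiples of the least such `q`. They resum to `1/q` times the same kind of sum. The half comes from
`1/q` if `q ≥ 2`, and from completing a full period, which has mean zero, if `q = 1`.

The bounds on `K` come from an expansion of `log sin` and a tangent line to a concave function. -/

/-! ### The smoothed kernel on the circle and its variation -/

/-- `log |1 - r e(t)|` for `0 ≤ r < 1`, where `e(t) = exp(2 π i t)`. -/
noncomputable def logDist (r t : ℝ) : ℝ :=
  Real.log ((1 - r) ^ 2 + 4 * r * Real.sin (Real.pi * t) ^ 2) / 2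

lemma logDist_arg_pos {r : ℝ} (h0 : 0 < r) (h1 : r < 1) (t : ℝ) :
    0 < (1 - r) ^ 2 + 4 * r * Real.sin (Real.pi * t) ^ 2 := by
  have : 0 < 1 - r := by linarith
  positivity

lemma continuous_logDist {r : ℝ} (h0 : 0 < r) (h1 : r < 1) : Continuous (logDist r) := by
  unfold logDist
  refine Continuous.div_const (Continuous.log (by fun_prop) fun t => ?_) 2
  exact (logDist_arg_pos h0 h1 t).ne'

lemma intervalIntegrable_logDist {r : ℝ} (h0 : 0 < r) (h1 : r < 1) (a b : ℝ) :
    IntervalIntegrable (logDist r) MeasureTheory.volume a b :=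
  (continuous_logDist h0 h1).intervalIntegrable a b

lemma logDist_add_one (r t : ℝ) : logDist r (t + 1) = logDist r t := by
  unfold logDist
  rw [mul_add, mul_one, Real.sin_add_pi, neg_sq]

lemma periodic_logDist (r : ℝ) : Function.Periodic (logDist r) 1 := logDist_add_one r

lemma logDist_neg (r t : ℝ) : logDist r (-t) = logDist r t := by
  unfold logDist
  rw [mul_neg, Real.sin_neg, neg_sq]

lemma logDist_one_sub (r t : ℝ) : logDist r (1 - t) = logDist r t := by
  rw [← logDist_neg r t, ← logDist_add_one r (-t)]
  congr 1
  ring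

lemma logDist_mono {r : ℝ} (h0 : 0 < r) (h1 : r < 1) {s t : ℝ}
    (h : Real.sin (Real.pi * s) ^ 2 ≤ Real.sin (Real.pi * t) ^ 2) : logDist r s ≤ logDist r t := by
  unfold logDist
  have := Real.log_le_log (logDist_arg_pos h0 h1 s) (by gcongr :
    (1 - r) ^ 2 + 4 * r * Real.sin (Real.pi * s) ^ 2
      ≤ (1 - r) ^ 2 + 4 * r * Real.sin (Real.pi * t) ^ 2)
  linarith

lemma sin_pi_mul_nonneg {t : ℝ} (h0 : 0 ≤ t) (h1 : t ≤ 1) : 0 ≤ Real.sin (Real.pi * t) :=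
  Real.sin_nonneg_of_nonneg_of_le_pi (by positivity) (by nlinarith [Real.pi_pos])

lemma sin_pi_mul_le_sin_pi_mul {s t : ℝ} (h0 : 0 ≤ s) (hst : s ≤ t) (ht : t ≤ 1 / 2) :
    Real.sin (Real.pi * s) ≤ Real.sin (Real.pi * t) :=
  Real.sin_le_sin_of_le_of_le_pi_div_two (by nlinarith [Real.pi_pos]) (by nlinarith [Real.pi_pos])
    (by nlinarith [Real.pi_pos])

lemma sin_pi_mul_one_sub (t : ℝ) : Real.sin (Real.pi * (1 - t)) = Real.sin (Real.pi * t) := by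
  rw [mul_sub, mul_one, Real.sin_pi_sub]

lemma sin_pi_mul_le_sin_pi_mul' {s t : ℝ} (h0 : 1 / 2 ≤ s) (hst : s ≤ t) (ht : t ≤ 1) :
    Real.sin (Real.pi * t) ≤ Real.sin (Real.pi * s) := by
  rw [← sin_pi_mul_one_sub s, ← sin_pi_mul_one_sub t]
  exact sin_pi_mul_le_sin_pi_mul (by linarith) (by linarith) (by linarith)

lemma logDist_monotoneOn {r : ℝ} (h0 : 0 < r) (h1 : r < 1) :
    MonotoneOn (logDist r) (Set.Icc 0 (1 / 2)) := by
  intro s hs t ht hst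
  refine logDist_mono h0 h1 ?_
  have := sin_pi_mul_le_sin_pi_mul hs.1 hst ht.2
  have := sin_pi_mul_nonneg hs.1 (by linarith [hs.2])
  gcongr

lemma log_one_sub_le_logDist {r : ℝ} (h0 : 0 < r) (h1 : r < 1) (t : ℝ) :
    Real.log (1 - r) ≤ logDist r t := by
  have h2 : logDist r 0 = Real.log (1 - r) := by
    simp [logDist]
  rw [← h2]
  exact logDist_mono h0 h1 (by simpa using sq_nonneg _)

lemma logDist_le_log_two {r : ℝ} (h0 : 0 < r) (h1 : r < 1) (t : ℝ) :
    logDist r t ≤ Real.log 2 := by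
  have h2 : logDist r (1 / 2) = Real.log (1 + r) := by
    have : Real.pi * (1 / 2) = Real.pi / 2 := by ring
    rw [logDist, this, Real.sin_pi_div_two,
      show (1 - r) ^ 2 + 4 * r * 1 ^ 2 = (1 + r) ^ 2 by ring, Real.log_pow]
    norm_num
  have h3 : logDist r t ≤ logDist r (1 / 2) := by
    refine logDist_mono h0 h1 ?_
    have : Real.pi * (1 / 2) = Real.pi / 2 := by ring
    rw [this, Real.sin_pi_div_two, one_pow]
    exact Real.sin_sq_le_one _
  rw [h2] at h3
  exact h3.trans (Real.log_le_log (by linarith) (by linarith))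

/-- The point `e(t) = exp(2 π i t)` of the unit circle. -/
noncomputable def circlePt (t : ℝ) : ℂ := Complex.exp ((2 * Real.pi * t : ℝ) * Complex.I)

lemma norm_circlePt (t : ℝ) : ‖circlePt t‖ = 1 := Complex.norm_exp_ofReal_mul_I _

lemma circlePt_pow (t : ℝ) (j : ℕ) : circlePt t ^ j = circlePt (j * t) := by
  rw [circlePt, circlePt, ← Complex.exp_nat_mul]
  congr 1
  push_cast
  ring

lemma circlePt_add_int (t : ℝ) (a : ℤ) : circlePt (t + a) = circlePt t := by
  rw [circlePt, circlePt]
  rw [show ((2 * Real.pi * (t + a) : ℝ) : ℂ) * Complex.I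
    = ((2 * Real.pi * t : ℝ) : ℂ) * Complex.I + a * (2 * Real.pi * Complex.I) by push_cast; ring]
  exact Complex.exp_periodic.int_mul a _

lemma norm_one_sub_mul_circlePt_sq (r t : ℝ) :
    ‖1 - r * circlePt t‖ ^ 2 = (1 - r) ^ 2 + 4 * r * Real.sin (Real.pi * t) ^ 2 := by
  have h : 1 - (r : ℂ) * circlePt t = ((1 - r * Real.cos (2 * Real.pi * t) : ℝ) : ℂ)
      + ((-(r * Real.sin (2 * Real.pi * t)) : ℝ) : ℂ) * Complex.I := by
    rw [circlePt, Complex.exp_mul_I, ← Complex.ofReal_cos, ← Complex.ofReal_sin]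
    push_cast
    ring
  rw [h, Complex.sq_norm, Complex.normSq_add_mul_I]
  have h1 : Real.cos (2 * Real.pi * t) = 1 - 2 * Real.sin (Real.pi * t) ^ 2 := by
    rw [mul_assoc, Real.cos_two_mul, Real.cos_sq']
    ring
  have h2 := Real.sin_sq_add_cos_sq (2 * Real.pi * t)
  have h3 : (1 - r * Real.cos (2 * Real.pi * t)) ^ 2 + (-(r * Real.sin (2 * Real.pi * t))) ^ 2
      = 1 - 2 * r * Real.cos (2 * Real.pi * t) + r ^ 2 := by
    linear_combination r ^ 2 * h2
  rw [h3, h1]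
  ring

lemma norm_one_sub_circlePt (t : ℝ) : ‖1 - circlePt t‖ = 2 * |Real.sin (Real.pi * t)| := by
  have h := norm_one_sub_mul_circlePt_sq 1 t
  rw [← Real.sqrt_sq (norm_nonneg (1 - circlePt t))]
  simp only [Complex.ofReal_one, one_mul] at h
  rw [h, show (1 - 1 : ℝ) ^ 2 + 4 * 1 * Real.sin (Real.pi * t) ^ 2
    = (2 * |Real.sin (Real.pi * t)|) ^ 2 by rw [mul_pow, sq_abs]; ring]
  exact Real.sqrt_sq (by positivity)

lemma log_norm_one_sub_mul_circlePt (r t : ℝ) :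
    Real.log ‖1 - r * circlePt t‖ = logDist r t := by
  rw [logDist, ← norm_one_sub_mul_circlePt_sq, Real.log_pow]
  push_cast
  ring

/-- Mean value property: `log |z - r|` has circle average zero when `r` lies inside the unit disc.
-/
lemma integral_logDist_zero_one {r : ℝ} (h0 : 0 < r) (h1 : r < 1) :
    ∫ t in (0 : ℝ)..1, logDist r t = 0 := by
  have h := circleAverage_log_norm_sub_const₀ (a := (r : ℂ))
    (by rw [Complex.norm_real, Real.norm_eq_abs, abs_of_pos h0]; exact h1)
  rw [Real.circleAverage, smul_eq_mul] at h
  have h2 : ∀ θ : ℝ, Real.log ‖circleMap 0 1 θ - r‖ = logDist r (θ / (2 * Real.pi)) := by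
    intro θ
    rw [← logDist_neg, ← log_norm_one_sub_mul_circlePt]
    congr 1
    have h3 : circleMap 0 1 θ = Complex.exp (θ * Complex.I) := by simp [circleMap]
    have h4 : circlePt (-(θ / (2 * Real.pi))) = Complex.exp (-(θ * Complex.I)) := by
      rw [circlePt]
      congr 1
      rw [show 2 * Real.pi * -(θ / (2 * Real.pi)) = -θ by field_simp]
      push_cast
      ring
    have h5 : circleMap 0 1 θ - r = Complex.exp (θ * Complex.I) *
        (1 - r * circlePt (-(θ / (2 * Real.pi)))) := by
      rw [h3, h4, Complex.exp_neg]
      field_simp [Complex.exp_ne_zero]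
    rw [h5, norm_mul, Complex.norm_exp_ofReal_mul_I, one_mul]
  have hpi := Real.pi_pos
  simp only [h2] at h
  rw [intervalIntegral.integral_comp_div (fun t => logDist r t) (by positivity)] at h
  simp only [zero_div, smul_eq_mul] at h
  rw [div_self (by positivity)] at h
  have : (2 * Real.pi) ≠ 0 := by positivity
  simpa [this] using h

lemma integral_logDist_zero_half {r : ℝ} (h0 : 0 < r) (h1 : r < 1) :
    ∫ t in (0 : ℝ)..(1 / 2), logDist r t = 0 := by
  have h2 := intervalIntegral.integral_add_adjacent_intervals
    (intervalIntegrable_logDist h0 h1 0 (1 / 2)) (intervalIntegrable_logDist h0 h1 (1 / 2) 1)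
  have h3 : ∫ t in (1 / 2 : ℝ)..1, logDist r t = ∫ t in (0 : ℝ)..(1 / 2), logDist r t := by
    have := intervalIntegral.integral_comp_sub_left (logDist r) (1 : ℝ) (a := 0) (b := 1 / 2)
    simp only [logDist_one_sub] at this
    rw [this]
    norm_num
  rw [integral_logDist_zero_one h0 h1, h3] at h2
  linarith

/-- The derivative of `logDist r`. -/
noncomputable def logDistDeriv (r t : ℝ) : ℝ :=
  4 * Real.pi * r * (Real.sin (Real.pi * t) * Real.cos (Real.pi * t)) /
    ((1 - r) ^ 2 + 4 * r * Real.sin (Real.pi * t) ^ 2)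

lemma hasDerivAt_logDist {r : ℝ} (h0 : 0 < r) (h1 : r < 1) (t : ℝ) :
    HasDerivAt (logDist r) (logDistDeriv r t) t := by
  have hs : HasDerivAt (fun t => Real.sin (Real.pi * t)) (Real.cos (Real.pi * t) * (Real.pi * 1)) t :=
    ((hasDerivAt_id t).const_mul Real.pi).sin
  have := ((((hs.pow 2).const_mul (4 * r)).const_add ((1 - r) ^ 2)).log
    (logDist_arg_pos h0 h1 t).ne').div_const 2
  refine this.congr_deriv ?_
  rw [logDistDeriv]
  have := (logDist_arg_pos h0 h1 t).ne'
  simp only [Pi.pow_apply]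
  field_simp
  push_cast
  ring

lemma continuous_logDistDeriv {r : ℝ} (h0 : 0 < r) (h1 : r < 1) :
    Continuous (logDistDeriv r) := by
  unfold logDistDeriv
  exact Continuous.div (by fun_prop) (by fun_prop) fun t => (logDist_arg_pos h0 h1 t).ne'

lemma logDistDeriv_add_one (r t : ℝ) : logDistDeriv r (t + 1) = logDistDeriv r t := by
  unfold logDistDeriv
  rw [mul_add, mul_one, Real.sin_add_pi, Real.cos_add_pi, neg_sq, neg_mul_neg]

lemma integral_logDistDeriv {r : ℝ} (h0 : 0 < r) (h1 : r < 1) (a b : ℝ) :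
    ∫ t in a..b, logDistDeriv r t = logDist r b - logDist r a :=
  intervalIntegral.integral_eq_sub_of_hasDerivAt (fun t _ => hasDerivAt_logDist h0 h1 t)
    ((continuous_logDistDeriv h0 h1).intervalIntegrable a b)

/-- The kernel rises on `[0, 1/2]` and falls back on `[1/2, 1]`, staying between `log (1 - r)` and
`log 2`. The growth is only logarithmic in `1/(1 - r)`, which makes `r = 1 - 1/n` affordable. -/
lemma integral_abs_logDistDeriv_le {r : ℝ} (h0 : 0 < r) (h1 : r < 1) :
    ∫ t in (0 : ℝ)..1, |logDistDeriv r t| ≤ 2 * Real.log (2 / (1 - r)) := by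
  have hc : Continuous fun t => |logDistDeriv r t| := (continuous_logDistDeriv h0 h1).abs
  rw [← intervalIntegral.integral_add_adjacent_intervals (hc.intervalIntegrable 0 (1 / 2))
    (hc.intervalIntegrable (1 / 2) 1)]
  have hlog : Real.log (2 / (1 - r)) = Real.log 2 - Real.log (1 - r) :=
    Real.log_div (by norm_num) (by linarith)
  have hpi := Real.pi_pos
  have e1 : ∫ t in (0 : ℝ)..(1 / 2), |logDistDeriv r t| = ∫ t in (0 : ℝ)..(1 / 2), logDistDeriv r t := by
    refine intervalIntegral.integral_congr fun t ht => ?_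
    rw [Set.uIcc_of_le (by norm_num)] at ht
    refine abs_of_nonneg (div_nonneg ?_ (logDist_arg_pos h0 h1 t).le)
    have := sin_pi_mul_nonneg ht.1 (by linarith [ht.2])
    have : 0 ≤ Real.cos (Real.pi * t) :=
      Real.cos_nonneg_of_neg_pi_div_two_le_of_le (by nlinarith [ht.1]) (by nlinarith [ht.2])
    positivity
  have e2 : ∫ t in (1 / 2 : ℝ)..1, |logDistDeriv r t| = ∫ t in (1 / 2 : ℝ)..1, -logDistDeriv r t := by
    refine intervalIntegral.integral_congr fun t ht => ?_
    rw [Set.uIcc_of_le (by norm_num)] at ht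
    refine abs_of_nonpos (div_nonpos_of_nonpos_of_nonneg ?_ (logDist_arg_pos h0 h1 t).le)
    have := sin_pi_mul_nonneg (by linarith [ht.1]) ht.2
    have : Real.cos (Real.pi * t) ≤ 0 :=
      Real.cos_nonpos_of_pi_div_two_le_of_le (by nlinarith [ht.1]) (by nlinarith [ht.2])
    exact mul_nonpos_of_nonneg_of_nonpos (by positivity) (mul_nonpos_of_nonneg_of_nonpos ‹_› ‹_›)
  rw [e1, e2, intervalIntegral.integral_neg, integral_logDistDeriv h0 h1, integral_logDistDeriv h0 h1,
    hlog]
  linarith [log_one_sub_le_logDist h0 h1 0, log_one_sub_le_logDist h0 h1 1,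
    logDist_le_log_two h0 h1 (1 / 2)]

/-! ### Riemann sums of the smoothed kernel -/

lemma sum_Icc_one_eq_sum_range {M : Type*} [AddCommMonoid M] (f : ℕ → M) (n : ℕ) :
    ∑ j ∈ Finset.Icc 1 n, f j = ∑ j ∈ Finset.range n, f (j + 1) := by
  induction n with
  | zero => simp
  | succ n ih => rw [Finset.sum_Icc_succ_top (by omega), ih, Finset.sum_range_succ]

/-- Comparison of a Riemann sum of `logDist r` with the integral, with an error controlled by the
total variation. -/
lemma sum_logDist_le {r η : ℝ} (h0 : 0 < r) (h1 : r < 1) (hη : 0 < η) (n : ℕ) :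
    ∑ j ∈ Finset.Icc 1 n, logDist r (j * η) ≤
      η⁻¹ * (∫ t in (0 : ℝ)..(n * η), logDist r t)
        + 2 * (n * η + 1) * Real.log (2 / (1 - r)) := by
  have hc : Continuous fun t => |logDistDeriv r t| := (continuous_logDistDeriv h0 h1).abs
  have step : ∀ j : ℕ, η * logDist r ((j + 1 : ℕ) * η) ≤
      (∫ t in (j * η)..((j + 1 : ℕ) * η), logDist r t)
        + η * ∫ t in (j * η)..((j + 1 : ℕ) * η), |logDistDeriv r t| := by
    intro j
    set a := (j : ℝ) * η with ha
    set b := ((j + 1 : ℕ) : ℝ) * η with hb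
    have hab : b = a + η := by rw [hb, ha]; push_cast; ring
    have hle : a ≤ b := by linarith
    -- On one cell the value at the right endpoint exceeds every other value by at most the
    -- variation over the cell.
    have h2 : ∫ t in a..b, (logDist r b - ∫ t in a..b, |logDistDeriv r t|) ≤
        ∫ t in a..b, logDist r t := by
      refine intervalIntegral.integral_mono_on hle (by simp) (intervalIntegrable_logDist h0 h1 a b)
        fun t ht => ?_
      have h3 : logDist r b - logDist r t ≤ ∫ t in t..b, |logDistDeriv r t| := by
        rw [← integral_logDistDeriv h0 h1]
        exact intervalIntegral.integral_mono_on ht.2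
          ((continuous_logDistDeriv h0 h1).intervalIntegrable _ _) (hc.intervalIntegrable _ _)
          fun x _ => le_abs_self _
      have h4 : ∫ t in t..b, |logDistDeriv r t| ≤ ∫ t in a..b, |logDistDeriv r t| :=
        intervalIntegral.integral_mono_interval ht.1 ht.2 le_rfl
          (Filter.Eventually.of_forall fun x => abs_nonneg _) (hc.intervalIntegrable _ _)
      linarith
    rw [intervalIntegral.integral_const, hab, smul_eq_mul] at h2
    rw [hab]
    have : (a + η - a) = η := by ring
    rw [this] at h2
    linarith
  have hsum : η * ∑ j ∈ Finset.Icc 1 n, logDist r (j * η) ≤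
      (∫ t in (0 : ℝ)..(n * η), logDist r t) + η * ∫ t in (0 : ℝ)..(n * η), |logDistDeriv r t| := by
    have e1 := intervalIntegral.sum_integral_adjacent_intervals (μ := MeasureTheory.volume)
      (f := logDist r) (a := fun k : ℕ => (k : ℝ) * η) (n := n)
      fun k _ => intervalIntegrable_logDist h0 h1 _ _
    have e2 := intervalIntegral.sum_integral_adjacent_intervals (μ := MeasureTheory.volume)
      (f := fun t => |logDistDeriv r t|) (a := fun k : ℕ => (k : ℝ) * η) (n := n)
      fun k _ => hc.intervalIntegrable _ _
    simp only [Nat.cast_zero, zero_mul] at e1 e2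
    rw [← e1, ← e2, Finset.mul_sum, Finset.mul_sum, ← Finset.sum_add_distrib,
      sum_Icc_one_eq_sum_range]
    exact Finset.sum_le_sum fun j _ => step j
  have hper : ∫ t in (0 : ℝ)..(n * η), |logDistDeriv r t| ≤
      (n * η + 1) * (2 * Real.log (2 / (1 - r))) := by
    have hp : Function.Periodic (fun t => |logDistDeriv r t|) 1 := fun t => by
      simp only [logDistDeriv_add_one]
    have h2 : ∫ t in (0 : ℝ)..(n * η), |logDistDeriv r t| ≤
        ∫ t in (0 : ℝ)..(⌈n * η⌉₊ : ℝ), |logDistDeriv r t| :=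
      intervalIntegral.integral_mono_interval le_rfl (by positivity) (Nat.le_ceil _)
          (Filter.Eventually.of_forall fun x => abs_nonneg _) (hc.intervalIntegrable _ _)
    have h3 := hp.intervalIntegral_add_zsmul_eq (⌈n * η⌉₊ : ℤ) 0
      (fun a b => hc.intervalIntegrable a b)
    simp only [zero_add, natCast_zsmul, nsmul_eq_mul, mul_one] at h3
    rw [h3] at h2
    have h4 := integral_abs_logDistDeriv_le h0 h1
    have h5 : (⌈n * η⌉₊ : ℝ) ≤ n * η + 1 := (Nat.ceil_lt_add_one (by positivity)).le
    have h6 : 0 ≤ ∫ t in (0 : ℝ)..1, |logDistDeriv r t| :=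
      intervalIntegral.integral_nonneg (by norm_num) fun x _ => abs_nonneg _
    calc _ ≤ _ := h2
      _ ≤ (n * η + 1) * ∫ t in (0 : ℝ)..1, |logDistDeriv r t| := by gcongr
      _ ≤ _ := by gcongr
  have : ∑ j ∈ Finset.Icc 1 n, logDist r (j * η) =
      η⁻¹ * (η * ∑ j ∈ Finset.Icc 1 n, logDist r (j * η)) :=
    (inv_mul_cancel_left₀ hη.ne' _).symm
  rw [this]
  calc _ ≤ η⁻¹ * ((∫ t in (0 : ℝ)..(n * η), logDist r t)
        + η * ((n * η + 1) * (2 * Real.log (2 / (1 - r))))) := by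
        gcongr
        exact hsum.trans (by gcongr)
    _ = _ := by field_simp

/-! ### Integrals of the smoothed kernel against those of `log (2 sin πt)` -/

lemma log_sin_pi_intervalIntegrable (a b : ℝ) :
    IntervalIntegrable (fun t => Real.log (Real.sin (Real.pi * t))) MeasureTheory.volume a b := by
  have h := (intervalIntegrable_log_sin (a := Real.pi * a) (b := Real.pi * b)).comp_mul_left
    (c := Real.pi)
  simpa [Real.pi_ne_zero] using h

/-- `log |1 - e(t)|` -/
noncomputable def logChord (t : ℝ) : ℝ := Real.log 2 + Real.log (Real.sin (Real.pi * t))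

lemma logChord_intervalIntegrable (a b : ℝ) :
    IntervalIntegrable logChord MeasureTheory.volume a b :=
  intervalIntegrable_const.add (log_sin_pi_intervalIntegrable a b)

lemma integral_logChord_eq {w : ℝ} (hw : w ≠ 0) :
    ∫ t in (0 : ℝ)..w, logChord t = w * (Real.log 2 + meanLogSin w) := by
  unfold logChord meanLogSin
  rw [intervalIntegral.integral_add intervalIntegrable_const (log_sin_pi_intervalIntegrable 0 w)]
  simp
  field_simp

lemma integral_logChord_zero_one : ∫ t in (0 : ℝ)..1, logChord t = 0 := by
  unfold logChord
  rw [intervalIntegral.integral_add intervalIntegrable_const (log_sin_pi_intervalIntegrable _ _),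
    intervalIntegral.integral_comp_mul_left (fun x => Real.log (Real.sin x)) Real.pi_ne_zero]
  simp [integral_log_sin_zero_pi]
  field_simp
  ring

lemma integral_logChord_zero_half : ∫ t in (0 : ℝ)..(1 / 2), logChord t = 0 := by
  unfold logChord
  rw [intervalIntegral.integral_add intervalIntegrable_const (log_sin_pi_intervalIntegrable _ _),
    intervalIntegral.integral_comp_mul_left (fun x => Real.log (Real.sin x)) Real.pi_ne_zero,
    mul_one_div, mul_zero, integral_log_sin_zero_pi_div_two]
  simp
  field_simp
  ring

lemma sin_pi_mul_pos {t : ℝ} (h0 : 0 < t) (h1 : t < 1) : 0 < Real.sin (Real.pi * t) :=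
  Real.sin_pos_of_pos_of_lt_pi (by have := Real.pi_pos; positivity) (by nlinarith [Real.pi_pos])

/-- With `S = sin πt`, the difference is half the log of `r + (1 - r)²/(4S²)`, and `S` decreases on
`[1/2, 1]`. -/
lemma logDist_sub_logChord_mono {r : ℝ} (h0 : 0 < r) (h1 : r < 1) {s t : ℝ} (hs : 1 / 2 ≤ s)
    (hst : s ≤ t) (ht : t < 1) :
    logDist r s - logChord s ≤ logDist r t - logChord t := by
  have hS := sin_pi_mul_pos (by linarith : (0 : ℝ) < s) (by linarith)
  have hT := sin_pi_mul_pos (by linarith : (0 : ℝ) < t) ht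
  have hle := sin_pi_mul_le_sin_pi_mul' hs hst ht.le
  have hA := logDist_arg_pos h0 h1 s
  have hB := logDist_arg_pos h0 h1 t
  unfold logDist logChord
  set S := Real.sin (Real.pi * s)
  set T := Real.sin (Real.pi * t)
  have h2 : ((1 - r) ^ 2 + 4 * r * S ^ 2) * T ^ 2 ≤ ((1 - r) ^ 2 + 4 * r * T ^ 2) * S ^ 2 := by
    have : T ^ 2 ≤ S ^ 2 := by gcongr
    nlinarith [sq_nonneg (1 - r)]
  have h3 := Real.log_le_log (by positivity) h2
  rw [Real.log_mul hA.ne' (by positivity), Real.log_mul hB.ne' (by positivity), Real.log_pow,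
    Real.log_pow] at h3
  push_cast at h3
  linarith

/-- The difference of the integrands increases on `[1/2, 1)`. If it is nonpositive at `w`, compare
on `[1/2, w]`, both integrals over `[0, 1/2]` being zero. If it is positive there, compare on `[w,
1]`, both integrals over `[0, 1]` being zero. -/
lemma integral_logDist_le_integral_logChord {r : ℝ} (h0 : 0 < r) (h1 : r < 1) {w : ℝ}
    (hw : 1 / 2 ≤ w) (hw1 : w < 1) :
    ∫ t in (0 : ℝ)..w, logDist r t ≤ ∫ t in (0 : ℝ)..w, logChord t := by
  have hd := intervalIntegrable_logDist h0 h1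
  have hc := logChord_intervalIntegrable
  by_cases h : logDist r w - logChord w ≤ 0
  · have h2 := intervalIntegral.integral_mono_on hw (hd _ _) (hc _ _) fun t ht =>
      show logDist r t ≤ logChord t by
        linarith [logDist_sub_logChord_mono h0 h1 ht.1 ht.2 hw1]
    have e1 := intervalIntegral.integral_add_adjacent_intervals (hd 0 (1 / 2)) (hd (1 / 2) w)
    have e2 := intervalIntegral.integral_add_adjacent_intervals (hc 0 (1 / 2)) (hc (1 / 2) w)
    rw [integral_logDist_zero_half h0 h1] at e1
    rw [integral_logChord_zero_half] at e2
    linarith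
  · have h2 := intervalIntegral.integral_mono_on_of_le_Ioo hw1.le (hc _ _) (hd _ _) fun t ht =>
      show logChord t ≤ logDist r t by
        linarith [logDist_sub_logChord_mono h0 h1 hw ht.1.le ht.2]
    have e1 := intervalIntegral.integral_add_adjacent_intervals (hd 0 w) (hd w 1)
    have e2 := intervalIntegral.integral_add_adjacent_intervals (hc 0 w) (hc w 1)
    rw [integral_logDist_zero_one h0 h1] at e1
    rw [integral_logChord_zero_one] at e2
    linarith

/-- An increasing function with integral zero over `[0, 1/2]` has nonpositive partial integrals. -/
lemma integral_logDist_nonpos {r : ℝ} (h0 : 0 < r) (h1 : r < 1) {w : ℝ}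
    (hw : 0 ≤ w) (hw1 : w ≤ 1 / 2) : ∫ t in (0 : ℝ)..w, logDist r t ≤ 0 := by
  have hd := intervalIntegrable_logDist h0 h1
  have hmono := logDist_monotoneOn h0 h1
  by_cases h : logDist r w ≤ 0
  · have := intervalIntegral.integral_mono_on hw (hd 0 w) (intervalIntegrable_const (c := (0 : ℝ)))
      fun t ht => (hmono ⟨ht.1, ht.2.trans hw1⟩ ⟨hw, hw1⟩ ht.2).trans h
    simpa using this
  · have := intervalIntegral.integral_mono_on hw1 (intervalIntegrable_const (c := (0 : ℝ)))
      (hd w (1 / 2)) fun t ht =>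
        (not_le.1 h).le.trans (hmono ⟨hw, hw1⟩ ⟨hw.trans ht.1, ht.2⟩ ht.1)
    have e1 := intervalIntegral.integral_add_adjacent_intervals (hd 0 w) (hd w (1 / 2))
    rw [integral_logDist_zero_half h0 h1] at e1
    simp at this
    linarith

lemma integral_logDist_eq_fract {r : ℝ} (h0 : 0 < r) (h1 : r < 1) (w : ℝ) :
    ∫ t in (0 : ℝ)..w, logDist r t = ∫ t in (0 : ℝ)..(Int.fract w), logDist r t := by
  have hd := intervalIntegrable_logDist h0 h1
  have h3 := (periodic_logDist r).intervalIntegral_add_zsmul_eq ⌊w⌋ (Int.fract w) hd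
  have h2 := (periodic_logDist r).intervalIntegral_add_eq (Int.fract w) 0
  rw [zero_add, integral_logDist_zero_one h0 h1] at h2
  rw [h2, zsmul_zero, zsmul_one, Int.fract_add_floor] at h3
  have := intervalIntegral.integral_add_adjacent_intervals (hd 0 (Int.fract w)) (hd (Int.fract w) w)
  linarith

lemma integral_logDist_le_of_lt_one {κ r w : ℝ}
    (hκ : ∀ w ∈ Set.Ioo (1 / 2 : ℝ) 1, Real.log 2 + meanLogSin w ≤ κ) (hκ0 : 0 ≤ κ)
    (h0 : 0 < r) (h1 : r < 1)
    (hw : 0 ≤ w) (hw1 : w < 1) : ∫ t in (0 : ℝ)..w, logDist r t ≤ κ * w := by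
  rcases le_or_gt w (1 / 2) with h | h
  · exact (integral_logDist_nonpos h0 h1 hw h).trans (by positivity)
  · refine (integral_logDist_le_integral_logChord h0 h1 h.le hw1).trans ?_
    rw [integral_logChord_eq (by linarith), mul_comm]
    exact mul_le_mul_of_nonneg_right (hκ w ⟨h, hw1⟩) hw

lemma integral_logDist_le {κ r w : ℝ}
    (hκ : ∀ w ∈ Set.Ioo (1 / 2 : ℝ) 1, Real.log 2 + meanLogSin w ≤ κ) (hκ0 : 0 ≤ κ)
    (h0 : 0 < r) (h1 : r < 1)
    (hw : 0 ≤ w) : ∫ t in (0 : ℝ)..w, logDist r t ≤ κ * w := by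
  rw [integral_logDist_eq_fract h0 h1]
  refine (integral_logDist_le_of_lt_one hκ hκ0 h0 h1 (Int.fract_nonneg _) (Int.fract_lt_one _)).trans ?_
  have : Int.fract w ≤ w := by
    rw [Int.fract]
    have : (0 : ℝ) ≤ ⌊w⌋ := by exact_mod_cast Int.floor_nonneg.2 hw
    linarith
  gcongr

/-- Full periods contribute nothing, so only the fractional part of `w` counts; once `w ≥ 1` it is
at most `w/2`. -/
lemma integral_logDist_le_half {κ r w : ℝ}
    (hκ : ∀ w ∈ Set.Ioo (1 / 2 : ℝ) 1, Real.log 2 + meanLogSin w ≤ κ) (hκ0 : 0 ≤ κ)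
    (h0 : 0 < r) (h1 : r < 1)
    (hw : 1 ≤ w) : ∫ t in (0 : ℝ)..w, logDist r t ≤ κ * w / 2 := by
  rw [integral_logDist_eq_fract h0 h1]
  refine (integral_logDist_le_of_lt_one hκ hκ0 h0 h1 (Int.fract_nonneg _) (Int.fract_lt_one _)).trans ?_
  have : Int.fract w ≤ w / 2 := by
    have h2 : (1 : ℝ) ≤ ⌊w⌋ := by exact_mod_cast Int.le_floor.2 (by simpa using hw)
    have := Int.fract_add_floor w
    have := Int.fract_lt_one w
    linarith
  rw [mul_div_assoc]
  gcongr

/-! ### Fourier expansion and resonant frequencies -/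

lemma hasSum_of_forall_eq {f g : ℕ → ℝ} {a : ℝ} (hg : HasSum g a) (h : ∀ m, f m = g m) :
    HasSum f a := by
  rwa [funext h]

lemma hasSum_logDist {r : ℝ} (h0 : 0 < r) (h1 : r < 1) (t : ℝ) :
    HasSum (fun m : ℕ => r ^ m / m * (circlePt (m * t)).re) (-logDist r t) := by
  have hz : ‖(r : ℂ) * circlePt t‖ < 1 := by
    rw [norm_mul, norm_circlePt, mul_one, Complex.norm_real, Real.norm_eq_abs, abs_of_pos h0]
    exact h1
  have h := Complex.hasSum_re (Complex.hasSum_taylorSeries_neg_log hz)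
  rw [Complex.neg_re, Complex.log_re, log_norm_one_sub_mul_circlePt] at h
  refine hasSum_of_forall_eq h fun m => ?_
  rw [mul_pow, circlePt_pow, ← Complex.ofReal_pow, mul_div_right_comm, ← Complex.ofReal_natCast,
    ← Complex.ofReal_div, Complex.re_ofReal_mul]

/-- The real part of `∑_{j=1}^n e(jα)`. -/
noncomputable def cosSum (n : ℕ) (α : ℝ) : ℝ := ∑ j ∈ Finset.Icc 1 n, (circlePt (j * α)).re

lemma abs_cosSum_le (n : ℕ) (α : ℝ) : |cosSum n α| ≤ n := by
  refine (Finset.abs_sum_le_sum_abs _ _).trans ?_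
  refine (Finset.sum_le_sum fun j _ => (Complex.abs_re_le_norm _).trans (norm_circlePt _).le).trans ?_
  simp

lemma four_mul_abs_sub_round_le (α : ℝ) : 4 * |α - round α| ≤ ‖1 - circlePt α‖ := by
  have h : circlePt α = circlePt (α - round α) := by
    rw [← circlePt_add_int (α - round α) (round α), sub_add_cancel]
  have hpi := Real.pi_pos
  have h2 := Real.mul_abs_le_abs_sin (x := Real.pi * (α - round α)) (by
    rw [abs_mul, abs_of_pos hpi]
    nlinarith [abs_sub_round α])
  rw [abs_mul, abs_of_pos hpi] at h2
  rw [h, norm_one_sub_circlePt]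
  have : 2 / Real.pi * (Real.pi * |α - round α|) = 2 * |α - round α| := by field_simp
  linarith

/-- Geometric sum: it is at most `2 / |1 - e(α)|`, and `|1 - e(α)|` is at least four times the
distance from `α` to the integers. -/
lemma abs_cosSum_le_of_le {δ : ℝ} (hδ : 0 < δ) (n : ℕ) {α : ℝ} (h : δ ≤ |α - round α|) :
    |cosSum n α| ≤ δ⁻¹ := by
  have hd := four_mul_abs_sub_round_le α
  have hpos : 0 < ‖1 - circlePt α‖ := by linarith
  have h2 : cosSum n α = (∑ j ∈ Finset.range n, circlePt α ^ (j + 1)).re := by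
    rw [cosSum, sum_Icc_one_eq_sum_range, Complex.re_sum]
    exact Finset.sum_congr rfl fun j _ => by rw [circlePt_pow]
  have h3 : (∑ j ∈ Finset.range n, circlePt α ^ (j + 1)) * (1 - circlePt α)
      = circlePt α * (1 - circlePt α ^ n) := by
    rw [← geom_sum_mul_neg (circlePt α) n, ← mul_assoc, Finset.mul_sum]
    congr 1
    exact Finset.sum_congr rfl fun j _ => pow_succ' _ _
  have h4 := congrArg norm h3
  rw [norm_mul, norm_mul, norm_circlePt, one_mul] at h4
  have h5 : ‖1 - circlePt α ^ n‖ ≤ 2 := by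
    refine (norm_sub_le _ _).trans ?_
    rw [norm_pow, norm_circlePt]
    norm_num
  rw [h2]
  refine (Complex.abs_re_le_norm _).trans ?_
  rw [eq_div_of_mul_eq hpos.ne' h4, div_le_iff₀ hpos]
  calc _ ≤ (2 : ℝ) := h5
    _ ≤ δ⁻¹ * (4 * δ) := by field_simp; norm_num
    _ ≤ _ := by gcongr; linarith

lemma hasSum_sum_logDist {r : ℝ} (h0 : 0 < r) (h1 : r < 1) (n : ℕ) (θ : ℝ) :
    HasSum (fun m : ℕ => r ^ m / m * cosSum n (m * θ))
      (-∑ j ∈ Finset.Icc 1 n, logDist r (j * θ)) := by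
  have h := hasSum_sum (s := Finset.Icc 1 n) fun j _ => hasSum_logDist h0 h1 (j * θ)
  rw [Finset.sum_neg_distrib] at h
  refine hasSum_of_forall_eq h fun m => ?_
  rw [cosSum, Finset.mul_sum]
  refine Finset.sum_congr rfl fun j _ => ?_
  rw [mul_left_comm]

lemma abs_le_of_hasSum_of_le {f : ℕ → ℝ} {a D ρ c : ℝ} (hf : HasSum f a) (k : ℕ)
    (h0 : 0 ≤ ρ) (h1 : ρ < 1) (hD : ∀ m < k, |f m| ≤ D) (hc : ∀ m, k ≤ m → |f m| ≤ c * ρ ^ m) :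
    |a| ≤ k * D + c * (ρ ^ k / (1 - ρ)) := by
  have h2 := (hasSum_nat_add_iff' k).2 hf
  have h3 : HasSum (fun m => c * ρ ^ (m + k)) (c * (ρ ^ k / (1 - ρ))) := by
    have := (hasSum_geometric_of_lt_one h0 h1).mul_left (c * ρ ^ k)
    rw [mul_assoc, ← div_eq_mul_inv] at this
    exact hasSum_of_forall_eq this fun m => by rw [pow_add]; ring
  have h4 : |a - ∑ i ∈ Finset.range k, f i| ≤ c * (ρ ^ k / (1 - ρ)) :=
    h2.norm_le_of_bounded h3 fun m => hc _ (Nat.le_add_left _ _)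
  have h5 : |∑ i ∈ Finset.range k, f i| ≤ k * D := by
    refine (Finset.abs_sum_le_sum_abs _ _).trans ?_
    refine (Finset.sum_le_sum fun i hi => hD i (Finset.mem_range.1 hi)).trans ?_
    simp
  calc |a| = |∑ i ∈ Finset.range k, f i + (a - ∑ i ∈ Finset.range k, f i)| := by
        rw [add_sub_cancel]
    _ ≤ _ := (abs_add_le _ _).trans (add_le_add h5 h4)

lemma cosSum_nat_mul_sub_int (n m : ℕ) (α : ℝ) (a : ℤ) :
    cosSum n (m * (α - a)) = cosSum n (m * α) := by
  refine Finset.sum_congr rfl fun j _ => ?_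
  have h : (j : ℝ) * (m * α) = j * (m * (α - a)) + ((j * m * a : ℤ) : ℝ) := by
    push_cast
    ring
  rw [h, circlePt_add_int]

/-- The frequencies `qm` of the kernel at radius `r` reassemble into `1/q` times the kernel at
radius `r^q` and angle `qθ`, where integer shifts are free. The term `m = 0` vanishes since division
by zero gives zero. -/
lemma hasSum_multiples {r : ℝ} (h0 : 0 < r) (h1 : r < 1) (n : ℕ) (θ : ℝ) {q : ℕ} (hq : 0 < q)
    (a : ℤ) :
    HasSum (fun m : ℕ => if q ∣ m then r ^ m / m * cosSum n (m * θ) else 0)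
      (-((q : ℝ)⁻¹ * ∑ j ∈ Finset.Icc 1 n, logDist (r ^ q) (j * (q * θ - a)))) := by
  have hinj : Function.Injective (fun m : ℕ => q * m) := fun x y h => Nat.eq_of_mul_eq_mul_left hq h
  rw [← hinj.hasSum_iff]
  · have h := (hasSum_sum_logDist (pow_pos h0 q) (pow_lt_one₀ h0.le h1 hq.ne') n
      (q * θ - a)).mul_left ((q : ℝ)⁻¹)
    rw [mul_neg] at h
    refine hasSum_of_forall_eq h fun m => ?_
    simp only [Function.comp_apply, dvd_mul_right, if_true]
    rw [cosSum_nat_mul_sub_int, ← pow_mul]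
    push_cast
    rw [mul_comm (q : ℝ) m, mul_assoc (m : ℝ), div_mul_eq_div_div, ← div_eq_inv_mul,
      div_mul_eq_mul_div]
  · intro m hm
    rw [if_neg]
    rintro ⟨x, rfl⟩
    exact hm ⟨x, rfl⟩

lemma abs_coeff_mul_cosSum_le {r : ℝ} (h0 : 0 < r) (n m : ℕ) (α : ℝ) :
    |r ^ m / m * cosSum n α| ≤ n * r ^ m := by
  rw [abs_mul, mul_comm, abs_of_nonneg (by positivity : 0 ≤ r ^ m / (m : ℝ))]
  refine mul_le_mul (abs_cosSum_le n α) ?_ (by positivity) (by positivity)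
  rcases Nat.eq_zero_or_pos m with rfl | hm
  · simp
  · exact div_le_self (by positivity) (by exact_mod_cast hm)

lemma abs_coeff_mul_cosSum_le_of_le {r : ℝ} (h0 : 0 < r) (h1 : r < 1) (n m : ℕ) {α δ : ℝ}
    (hδ : 0 < δ) (h : m ≠ 0 → δ ≤ |α - round α|) :
    |r ^ m / m * cosSum n α| ≤ δ⁻¹ := by
  rcases Nat.eq_zero_or_pos m with rfl | hm
  · simpa using hδ.le
  · rw [abs_mul, abs_of_nonneg (by positivity)]
    have h2 : r ^ m / m ≤ 1 :=
      (div_le_self (by positivity) (by exact_mod_cast hm)).trans (pow_le_one₀ h0.le h1.le)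
    calc _ ≤ 1 * δ⁻¹ := mul_le_mul h2 (abs_cosSum_le_of_le hδ n (h hm.ne')) (abs_nonneg _) zero_le_one
      _ = _ := one_mul _

lemma sum_logDist_le_of_forall {r δ : ℝ} (h0 : 0 < r) (h1 : r < 1) (hδ : 0 < δ) (n k : ℕ) {θ : ℝ}
    (h : ∀ m, 0 < m → m < k → δ ≤ |m * θ - round (m * θ)|) :
    ∑ j ∈ Finset.Icc 1 n, logDist r (j * θ) ≤ k * δ⁻¹ + n * (r ^ k / (1 - r)) := by
  have := abs_le_of_hasSum_of_le (hasSum_sum_logDist h0 h1 n θ) k h0.le h1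
    (fun m hm => abs_coeff_mul_cosSum_le_of_le h0 h1 n m hδ fun h' => h m (Nat.pos_of_ne_zero h') hm)
    (fun m _ => abs_coeff_mul_cosSum_le h0 n m _)
  rw [abs_neg] at this
  exact (le_abs_self _).trans this

/-- Subtracting the multiples of `q` leaves frequencies that are nonresonant below `k`, each costing
`δ⁻¹`, and a geometric tail beyond `k`. -/
lemma sum_logDist_le_of_forall_not_dvd {r δ : ℝ} (h0 : 0 < r) (h1 : r < 1) (hδ : 0 < δ) (n k : ℕ)
    {θ : ℝ} {q : ℕ} (hq : 0 < q) (a : ℤ)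
    (h : ∀ m, m < k → ¬ q ∣ m → δ ≤ |m * θ - round (m * θ)|) :
    ∑ j ∈ Finset.Icc 1 n, logDist r (j * θ) ≤
      (q : ℝ)⁻¹ * ∑ j ∈ Finset.Icc 1 n, logDist (r ^ q) (j * (q * θ - a))
        + (k * δ⁻¹ + n * (r ^ k / (1 - r))) := by
  have hs := (hasSum_sum_logDist h0 h1 n θ).sub (hasSum_multiples h0 h1 n θ hq a)
  have := abs_le_of_hasSum_of_le (D := δ⁻¹) (c := n) (ρ := r) hs k h0.le h1 ?_ ?_
  · have := (abs_le.1 this).1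
    linarith
  · intro m hm
    split_ifs with hd
    · simpa using hδ.le
    · rw [sub_zero]
      exact abs_coeff_mul_cosSum_le_of_le h0 h1 n m hδ fun _ => h m hm hd
  · intro m _
    split_ifs with hd
    · rw [sub_self, abs_zero]
      positivity
    · rw [sub_zero]
      exact abs_coeff_mul_cosSum_le h0 n m _

/-- If `q` is the least positive integer with `qθ` close to an integer, then `mθ` is far from
the integers for small `m` not divisible by `q`. -/
lemma le_abs_sub_round_of_not_dvd {δ θ : ℝ} {k q m : ℕ} (hk : 2 * k * δ ≤ 1) (hqk : q < k)
    (hmk : m < k) (hq : 0 < q) (hδ : |q * θ - round (q * θ)| < δ)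
    (hmin : ∀ p, 0 < p → p < q → δ ≤ |p * θ - round (p * θ)|) (hm : ¬ q ∣ m) :
    δ ≤ |m * θ - round (m * θ)| := by
  by_contra! hlt
  set a := round (q * θ)
  set b := round (m * θ)
  have hδ0 : 0 < δ := (abs_nonneg _).trans_lt hδ
  have hq' : (0 : ℝ) < q := by exact_mod_cast hq
  have hm0 : 0 < m := Nat.pos_of_ne_zero fun h => hm (h ▸ dvd_zero q)
  have hm' : (0 : ℝ) < m := by exact_mod_cast hm0
  have hqk' : (q : ℝ) < k := by exact_mod_cast hqk
  have hmk' : (m : ℝ) < k := by exact_mod_cast hmk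
  -- This integer difference has absolute value less than `2kδ ≤ 1`, so it vanishes.
  have hab : (m : ℤ) * a = q * b := by
    have h1 : |((m * a - q * b : ℤ) : ℝ)| < 1 := by
      have h2 : ((m * a - q * b : ℤ) : ℝ) = q * (m * θ - b) - m * (q * θ - a) := by
        push_cast
        ring
      rw [h2]
      refine (abs_sub _ _).trans_lt ?_
      rw [abs_mul, abs_mul, abs_of_pos hq', abs_of_pos hm']
      nlinarith
    rw [← Int.cast_abs] at h1
    have h3 : |(m * a - q * b : ℤ)| < 1 := by exact_mod_cast h1
    have := Int.abs_lt_one_iff.1 h3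
    linarith
  -- A common factor `d` would make `q/d` an even better denominator, against minimality.
  have hg : Int.gcd q a = 1 := by
    by_contra hne
    set d := Int.gcd q a
    have hd0 : 0 < d := Int.gcd_pos_of_ne_zero_left _ (by exact_mod_cast hq.ne')
    obtain ⟨p, hp⟩ : d ∣ q := by exact_mod_cast Int.gcd_dvd_left (q : ℤ) a
    obtain ⟨c, hc⟩ : (d : ℤ) ∣ a := Int.gcd_dvd_right (q : ℤ) a
    have hp0 : 0 < p := Nat.pos_of_ne_zero fun h => by rw [h] at hp; omega
    have hpq : p < q := by
      have : 2 ≤ d := by omega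
      nlinarith
    have h1 := (hmin p hp0 hpq).trans (round_le (p * θ) c)
    have h2 : q * θ - a = d * (p * θ - c) := by
      rw [hc, hp]
      push_cast
      ring
    rw [h2, abs_mul, Nat.abs_cast] at hδ
    have : (1 : ℝ) ≤ d := by exact_mod_cast hd0
    nlinarith
  have : (q : ℤ) ∣ m := by
    have h1 : (q : ℤ) ∣ m * a := ⟨b, hab⟩
    exact Int.dvd_of_dvd_mul_left_of_gcd_one h1 hg
  exact hm (by exact_mod_cast this)

/-! ### Upper bound for the Sudler product -/

/-- On the circle `|1 - z| ≤ 2/(1 + r) · |1 - rz|`, with equality at `z = -1`, and the factor is at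
most `e^{1 - r}`. -/
lemma norm_one_sub_circlePt_le {r : ℝ} (h0 : 0 < r) (h1 : r < 1) (t : ℝ) :
    ‖1 - circlePt t‖ ≤ Real.exp ((1 - r) + logDist r t) := by
  have hA := logDist_arg_pos h0 h1 t
  have h2 : Real.exp (logDist r t) = ‖1 - r * circlePt t‖ := by
    rw [← log_norm_one_sub_mul_circlePt, Real.exp_log]
    refine norm_pos_iff.2 fun h => ?_
    rw [← norm_one_sub_mul_circlePt_sq, h] at hA
    simp at hA
  have h3 : (1 - r) / (1 + r) + 1 ≤ Real.exp (1 - r) := by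
    refine le_trans ?_ (Real.add_one_le_exp (1 - r))
    have : (1 - r) / (1 + r) ≤ 1 - r := div_le_self (by linarith) (by linarith)
    linarith
  have h4 : ‖1 - circlePt t‖ ≤ (2 / (1 + r)) * ‖1 - r * circlePt t‖ := by
    refine abs_le_of_sq_le_sq' ?_ (by positivity) |>.2
    have e := norm_one_sub_mul_circlePt_sq 1 t
    rw [Complex.ofReal_one, one_mul] at e
    rw [mul_pow, e, norm_one_sub_mul_circlePt_sq, div_pow, div_mul_eq_mul_div, le_div_iff₀ (by positivity)]
    nlinarith [Real.sin_sq_le_one (Real.pi * t), sq_nonneg (1 - r), mul_nonneg (sq_nonneg (1 - r))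
      (sub_nonneg.2 (Real.sin_sq_le_one (Real.pi * t)))]
  rw [Real.exp_add, h2]
  refine h4.trans ?_
  have h5 : 2 / (1 + r) = (1 - r) / (1 + r) + 1 := by
    field_simp
    ring
  rw [h5]
  gcongr

lemma prod_norm_one_sub_circlePt_le {r : ℝ} (h0 : 0 < r) (h1 : r < 1) (n : ℕ) (θ : ℝ) :
    ∏ j ∈ Finset.Icc 1 n, ‖1 - circlePt (j * θ)‖ ≤
      Real.exp (n * (1 - r) + ∑ j ∈ Finset.Icc 1 n, logDist r (j * θ)) := by
  refine (Finset.prod_le_prod (fun _ _ => norm_nonneg _)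
    fun j _ => norm_one_sub_circlePt_le h0 h1 _).trans ?_
  rw [← Real.exp_sum, Finset.sum_add_distrib,
    Finset.sum_const, Nat.card_Icc, Nat.add_sub_cancel, nsmul_eq_mul]

lemma sum_logDist_abs (r θ : ℝ) (n : ℕ) :
    ∑ j ∈ Finset.Icc 1 n, logDist r (j * |θ|) = ∑ j ∈ Finset.Icc 1 n, logDist r (j * θ) := by
  rcases abs_choice θ with h | h <;> rw [h]
  simp only [mul_neg, logDist_neg]

lemma log_two_div_nonneg {r : ℝ} (h0 : 0 < r) (h1 : r < 1) : 0 ≤ Real.log (2 / (1 - r)) := by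
  refine Real.log_nonneg ?_
  rw [le_div_iff₀ (by linarith)]
  linarith

lemma sum_logDist_le_mul {κ r : ℝ}
    (hκ : ∀ w ∈ Set.Ioo (1 / 2 : ℝ) 1, Real.log 2 + meanLogSin w ≤ κ) (hκ0 : 0 ≤ κ)
    (h0 : 0 < r) (h1 : r < 1) (n : ℕ) (η : ℝ) :
    ∑ j ∈ Finset.Icc 1 n, logDist r (j * η) ≤
      κ * n + 2 * (n * |η| + 1) * Real.log (2 / (1 - r)) := by
  have hV := log_two_div_nonneg h0 h1
  rcases eq_or_ne η 0 with rfl | hη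
  · have : ∀ j ∈ Finset.Icc 1 n, logDist r (j * 0) ≤ 0 := fun j _ => by
      rw [mul_zero, logDist, mul_zero, Real.sin_zero]
      refine div_nonpos_of_nonpos_of_nonneg (Real.log_nonpos ?_ ?_) (by norm_num) <;> nlinarith
    exact (Finset.sum_nonpos this).trans (by positivity)
  · have hη' : 0 < |η| := abs_pos.2 hη
    rw [← sum_logDist_abs]
    refine (sum_logDist_le h0 h1 hη' n).trans ?_
    have := integral_logDist_le hκ hκ0 h0 h1 (w := n * |η|) (by positivity)
    refine add_le_add_left ?_ _
    calc _ ≤ |η|⁻¹ * (κ * (n * |η|)) := by gcongr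
      _ = κ * n := by field_simp

lemma sum_logDist_le_half_mul {κ r : ℝ}
    (hκ : ∀ w ∈ Set.Ioo (1 / 2 : ℝ) 1, Real.log 2 + meanLogSin w ≤ κ) (hκ0 : 0 ≤ κ)
    (h0 : 0 < r) (h1 : r < 1) (n : ℕ) {η : ℝ} (h : 1 ≤ n * |η|) :
    ∑ j ∈ Finset.Icc 1 n, logDist r (j * η) ≤
      κ * n / 2 + 2 * (n * |η| + 1) * Real.log (2 / (1 - r)) := by
  have hη' : 0 < |η| := by
    rcases (abs_nonneg η).eq_or_lt with h' | h'
    · rw [← h'] at h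
      norm_num at h
    · exact h'
  rw [← sum_logDist_abs]
  refine (sum_logDist_le h0 h1 hη' n).trans ?_
  have := integral_logDist_le_half hκ hκ0 h0 h1 h
  refine add_le_add_left ?_ _
  calc _ ≤ |η|⁻¹ * (κ * (n * |η|) / 2) := by gcongr
    _ = κ * n / 2 := by field_simp

/-- Away from the integers (at distance at least `1/n`), the Sudler product is smaller than
`exp (κ n)` up to a constant. -/
lemma exists_prod_le_of_one_le {κ : ℝ}
    (hκ : ∀ w ∈ Set.Ioo (1 / 2 : ℝ) 1, Real.log 2 + meanLogSin w ≤ κ) (hκ0 : 0 < κ) (hκ1 : κ ≤ 1) :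
    ∃ B : ℝ, ∀ (n : ℕ) (θ : ℝ), 1 ≤ n * |θ - round θ| →
      ∏ j ∈ Finset.Icc 1 n, ‖1 - circlePt (j * θ)‖ ≤ Real.exp (κ * n + B) := by
  -- Budget for the exponent per unit of `n`: `κ/8` each for smoothing, for the Fourier tail and for
  -- the variation, plus `κ/2` for the main term. The total is `7κ/8`.
  set ρ := 1 - κ / 8 with hρ
  have h0 : 0 < ρ := by linarith
  have h1 : ρ < 1 := by linarith
  set V := Real.log (2 / (1 - ρ)) with hV
  have hV0 : 0 ≤ V := log_two_div_nonneg h0 h1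
  obtain ⟨k, hk⟩ : ∃ k : ℕ, ρ ^ k < κ / 8 * (κ / 8) :=
    exists_pow_lt_of_lt_one (by positivity) h1
  have hk' : ρ ^ k / (1 - ρ) ≤ κ / 8 := by
    rw [hρ, sub_sub_cancel, div_le_iff₀ (by positivity)]
    exact hk.le
  -- The first bound gives `2kδ ≤ 1`, needed to isolate the multiples of `q`; the second keeps the
  -- variation error `2nδV` below `nκ/8`.
  set δ : ℝ := min (1 / (2 * (k + 1))) (κ / (16 * (V + 1))) with hδ
  have hδ0 : 0 < δ := by positivity
  have hδk : 2 * k * δ ≤ 1 := by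
    have : δ ≤ 1 / (2 * (k + 1)) := min_le_left _ _
    calc 2 * k * δ ≤ 2 * (k + 1) * (1 / (2 * (k + 1))) := by gcongr; linarith
      _ = 1 := by field_simp
  have hδV : δ * V ≤ κ / 16 := by
    have : δ ≤ κ / (16 * (V + 1)) := min_le_right _ _
    calc δ * V ≤ κ / (16 * (V + 1)) * (V + 1) := by gcongr; linarith
      _ = κ / 16 := by field_simp
  refine ⟨k * δ⁻¹ + 2 * V, fun n θ hnθ => (prod_norm_one_sub_circlePt_le h0 h1 n θ).trans
    (Real.exp_le_exp.2 ?_)⟩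
  have hn : (n : ℝ) * (ρ ^ k / (1 - ρ)) ≤ n * (κ / 8) := by gcongr
  rw [show n * (1 - ρ) = n * (κ / 8) by rw [hρ]; ring]
  by_cases hex : ∃ q, 0 < q ∧ q < k ∧ |q * θ - round (q * θ)| < δ
  · classical
    obtain ⟨hq0, hqk, hqδ⟩ := Nat.find_spec hex
    have hmin : ∀ p, 0 < p → p < Nat.find hex → δ ≤ |p * θ - round (p * θ)| := by
      intro p hp hpq
      by_contra! h
      exact Nat.find_min hex hpq ⟨hp, hpq.trans hqk, h⟩
    set q := Nat.find hex
    have h2 := sum_logDist_le_of_forall_not_dvd h0 h1 hδ0 n k hq0 (round (q * θ)) fun m hm hd =>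
      le_abs_sub_round_of_not_dvd hδk hqk hm hq0 hqδ hmin hd
    set η := q * θ - round (q * θ) with hη
    have hrq0 : 0 < ρ ^ q := pow_pos h0 q
    have hrq1 : ρ ^ q < 1 := pow_lt_one₀ h0.le h1 hq0.ne'
    have hVq : Real.log (2 / (1 - ρ ^ q)) ≤ V := by
      have : ρ ^ q ≤ ρ := pow_le_of_le_one h0.le h1.le hq0.ne'
      refine Real.log_le_log (div_pos two_pos (by linarith)) ?_
      gcongr
    have herr : 2 * (n * |η| + 1) * Real.log (2 / (1 - ρ ^ q)) ≤ n * (κ / 8) + 2 * V := by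
      have hl := log_two_div_nonneg hrq0 hrq1
      calc _ ≤ 2 * (n * δ + 1) * V := by gcongr
        _ = 2 * n * (δ * V) + 2 * V := by ring
        _ ≤ 2 * n * (κ / 16) + 2 * V := by gcongr
        _ = _ := by ring
    have hmain : (q : ℝ)⁻¹ * ∑ j ∈ Finset.Icc 1 n, logDist (ρ ^ q) (j * η) ≤
        κ * n / 2 + n * (κ / 8) + 2 * V := by
      have hqpos : (0 : ℝ) < q := by exact_mod_cast hq0
      rw [inv_mul_le_iff₀ hqpos]
      -- For `q = 1` the points `jη` sweep at least one full period, which halves the integral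
      -- bound; for `q ≥ 2` the prefactor `1/q` does the halving.
      rcases Nat.lt_or_ge q 2 with hq | hq
      · have hq1 : q = 1 := by omega
        have := sum_logDist_le_half_mul hκ hκ0.le hrq0 hrq1 n (η := η) (by
          rw [hη, hq1, Nat.cast_one, one_mul]
          exact hnθ)
        have e : (q : ℝ) = 1 := by rw [hq1, Nat.cast_one]
        rw [e, one_mul]
        linarith
      · have := sum_logDist_le_mul hκ hκ0.le hrq0 hrq1 n η
        have hq2 : (2 : ℝ) ≤ q := by exact_mod_cast hq
        have h3 : 2 * (κ * n / 2 + n * (κ / 8) + 2 * V) ≤ q * (κ * n / 2 + n * (κ / 8) + 2 * V) := by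
          gcongr
        have : 0 ≤ n * (κ / 8) := by positivity
        linarith
    have : 0 ≤ n * (κ / 8) := by positivity
    linarith
  · push Not at hex
    have h2 := sum_logDist_le_of_forall h0 h1 hδ0 n k fun m hm0 hmk => hex m hm0 hmk
    have : 0 ≤ n * (κ / 8) := by positivity
    linarith

lemma prod_le_of_le_one {κ : ℝ}
    (hκ : ∀ w ∈ Set.Ioo (1 / 2 : ℝ) 1, Real.log 2 + meanLogSin w ≤ κ) (hκ0 : 0 ≤ κ)
    {n : ℕ} (hn : 2 ≤ n) {θ : ℝ} (h : n * |θ - round θ| ≤ 1) :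
    ∏ j ∈ Finset.Icc 1 n, ‖1 - circlePt (j * θ)‖ ≤
      Real.exp (κ * n + (1 + 4 * Real.log (2 * n))) := by
  have hn' : (2 : ℝ) ≤ n := by exact_mod_cast hn
  have hinv : (n : ℝ)⁻¹ ≤ 2⁻¹ := by gcongr
  have h0 : 0 < 1 - (n : ℝ)⁻¹ := by linarith
  have h1 : 1 - (n : ℝ)⁻¹ < 1 := by
    have : 0 < (n : ℝ)⁻¹ := by positivity
    linarith
  refine (prod_norm_one_sub_circlePt_le h0 h1 n θ).trans (Real.exp_le_exp.2 ?_)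
  have h2 := sum_logDist_le_mul hκ hκ0 h0 h1 n (θ - round θ)
  have h3 : ∑ j ∈ Finset.Icc 1 n, logDist (1 - (n : ℝ)⁻¹) (j * (θ - round θ)) =
      ∑ j ∈ Finset.Icc 1 n, logDist (1 - (n : ℝ)⁻¹) (j * θ) := by
    refine Finset.sum_congr rfl fun j _ => ?_
    have := (periodic_logDist (1 - (n : ℝ)⁻¹)).sub_int_mul_eq (x := j * θ) (j * round θ)
    rw [← this]
    congr 1
    push_cast
    ring
  have hV := log_two_div_nonneg h0 h1
  rw [h3] at h2
  rw [sub_sub_cancel] at h2 hV ⊢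
  rw [div_inv_eq_mul] at h2 hV
  rw [mul_inv_cancel₀ (by positivity)]
  have : 2 * (n * |θ - round θ| + 1) * Real.log (2 * n) ≤ 2 * (1 + 1) * Real.log (2 * n) := by
    gcongr
  linarith

/-- The uniform upper bound for the Sudler product. -/
lemma exists_prod_le {κ : ℝ}
    (hκ : ∀ w ∈ Set.Ioo (1 / 2 : ℝ) 1, Real.log 2 + meanLogSin w ≤ κ) (hκ0 : 0 < κ) (hκ1 : κ ≤ 1) :
    ∃ B : ℝ, ∀ (n : ℕ) (θ : ℝ), 2 ≤ n →
      ∏ j ∈ Finset.Icc 1 n, ‖1 - circlePt (j * θ)‖ ≤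
        Real.exp (κ * n + (B + 4 * Real.log (2 * n))) := by
  obtain ⟨B, hB⟩ := exists_prod_le_of_one_le hκ hκ0 hκ1
  refine ⟨max B 1, fun n θ hn => ?_⟩
  have hn' : (2 : ℝ) ≤ n := by exact_mod_cast hn
  have hlog : 0 ≤ Real.log (2 * n) := Real.log_nonneg (by linarith)
  have := le_max_left B 1
  have := le_max_right B 1
  rcases le_total 1 (n * |θ - round θ|) with h | h
  · exact (hB n θ h).trans (Real.exp_le_exp.2 (by linarith))
  · exact (prod_le_of_le_one hκ hκ0.le hn h).trans (Real.exp_le_exp.2 (by linarith))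

/-! ### Lower bound for the Sudler product -/

lemma logChord_le_log_two {t : ℝ} (h0 : 0 ≤ t) (h1 : t ≤ 1) : logChord t ≤ Real.log 2 := by
  have := Real.log_nonpos (sin_pi_mul_nonneg h0 h1) (Real.sin_le_one _)
  unfold logChord
  linarith

lemma logChord_le_logChord {s t : ℝ} (h0 : 0 < s) (hst : s ≤ t) (ht : t ≤ 1 / 2) :
    logChord s ≤ logChord t := by
  have := Real.log_le_log (sin_pi_mul_pos h0 (by linarith)) (sin_pi_mul_le_sin_pi_mul h0.le hst ht)
  unfold logChord
  linarith

lemma logChord_le_logChord' {s t : ℝ} (h0 : 1 / 2 ≤ s) (hst : s ≤ t) (ht : t < 1) :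
    logChord t ≤ logChord s := by
  have := Real.log_le_log (sin_pi_mul_pos (by linarith) ht)
    (sin_pi_mul_le_sin_pi_mul' h0 hst ht.le)
  unfold logChord
  linarith

lemma exp_logChord {t : ℝ} (h0 : 0 < t) (h1 : t < 1) :
    Real.exp (logChord t) = ‖1 - circlePt t‖ := by
  have := sin_pi_mul_pos h0 h1
  rw [logChord, Real.exp_add, Real.exp_log two_pos, Real.exp_log this, norm_one_sub_circlePt,
    abs_of_pos this]

lemma integral_logChord_le_of_forall {a h c : ℝ} (hh : 0 ≤ h)
    (hc : ∀ t, a < t → t < a + h → logChord t ≤ c) :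
    ∫ t in a..(a + h), logChord t ≤ h * c := by
  have := intervalIntegral.integral_mono_on_of_le_Ioo (le_add_of_nonneg_right hh)
    (logChord_intervalIntegrable a (a + h)) (intervalIntegrable_const (c := c))
    fun t ht => hc t ht.1 ht.2
  simpa using this

/-- Cells left of `1/2` are bounded by their right endpoint and cells right of it by their left
endpoint. The cell containing the peak costs `log 2`, and the node `nh` is left unused, whence the
correction. -/
lemma integral_logChord_le_sum {h : ℝ} (hh : 0 < h) {n : ℕ} (h0 : 1 / 2 < n * h) (h1 : n * h < 1) :
    ∫ t in (0 : ℝ)..(n * h), logChord t ≤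
      h * (∑ j ∈ Finset.Icc 1 n, logChord (j * h) + (Real.log 2 - logChord (n * h))) := by
  set J := ⌊1 / 2 / h⌋₊ with hJ
  have hJ1 : J * h ≤ 1 / 2 := by
    rw [← le_div_iff₀ hh]
    exact Nat.floor_le (by positivity)
  have hJ2 : 1 / 2 < (J + 1) * h := by
    rw [← div_lt_iff₀ hh]
    exact Nat.lt_floor_add_one _
  have hJn : J < n := by
    have : (J : ℝ) < n := lt_of_mul_lt_mul_right (hJ1.trans_lt h0) hh.le
    exact_mod_cast this
  obtain ⟨m, rfl⟩ : ∃ m, n = J + 1 + m := ⟨n - (J + 1), by omega⟩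
  have e := intervalIntegral.sum_integral_adjacent_intervals (μ := MeasureTheory.volume)
    (f := logChord) (a := fun k : ℕ => (k : ℝ) * h) (n := J + 1 + m)
    fun k _ => logChord_intervalIntegrable _ _
  simp only [Nat.cast_zero, zero_mul] at e
  have hcell : ∀ j : ℕ, ((j + 1 : ℕ) : ℝ) * h = j * h + h := fun j => by push_cast; ring
  simp only [hcell] at e
  push_cast at h0 h1
  rw [← e, sum_Icc_one_eq_sum_range, add_assoc J 1 m, add_comm 1 m, Finset.sum_range_add,
    Finset.sum_range_succ', Finset.sum_range_add (fun j : ℕ => logChord ((j + 1 : ℕ) * h)) J (m + 1),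
    Finset.sum_range_succ _ m]
  have c1 : ∑ j ∈ Finset.range J, ∫ t in (j * h)..(j * h + h), logChord t ≤
      h * ∑ j ∈ Finset.range J, logChord ((j + 1 : ℕ) * h) := by
    rw [Finset.mul_sum]
    refine Finset.sum_le_sum fun j hj => integral_logChord_le_of_forall hh.le fun t ht ht' => ?_
    have hj' : ((j + 1 : ℕ) : ℝ) ≤ J := by exact_mod_cast Finset.mem_range.1 hj
    refine logChord_le_logChord (lt_of_le_of_lt (by positivity) ht) ?_ ?_
    · rw [hcell]
      exact ht'.le
    · exact (mul_le_mul_of_nonneg_right hj' hh.le).trans hJ1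
  have c2 : ∫ t in (((J + 0 : ℕ) : ℝ) * h)..(((J + 0 : ℕ) : ℝ) * h + h), logChord t ≤
      h * Real.log 2 := by
    refine integral_logChord_le_of_forall hh.le fun t ht ht' => ?_
    have hm : 0 ≤ (m : ℝ) * h := by positivity
    push_cast at ht ht'
    exact logChord_le_log_two (lt_of_le_of_lt (by positivity) ht).le (by nlinarith)
  have c3 : ∑ j ∈ Finset.range m,
        ∫ t in (((J + (j + 1) : ℕ) : ℝ) * h)..(((J + (j + 1) : ℕ) : ℝ) * h + h), logChord t ≤
      h * ∑ j ∈ Finset.range m, logChord ((J + j + 1 : ℕ) * h) := by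
    rw [Finset.mul_sum]
    refine Finset.sum_le_sum fun j hj => integral_logChord_le_of_forall hh.le fun t ht ht' => ?_
    have hj' : ((j + 1 : ℕ) : ℝ) ≤ m := by exact_mod_cast Finset.mem_range.1 hj
    push_cast at hj' ht ht' ⊢
    have hjh : 0 ≤ (j : ℝ) * h := by positivity
    refine logChord_le_logChord' ?_ ?_ ?_
    · nlinarith
    · linarith
    · nlinarith
  have e4 : ((J + (m + 1) : ℕ) : ℝ) = ((J + m + 1 : ℕ) : ℝ) := by rw [add_assoc]
  rw [e4]
  linarith

/-- The lower bound for the Sudler product at the point `w / n`. -/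
lemma exp_le_prod {w : ℝ} (hw : 1 / 2 < w) (hw1 : w < 1) {n : ℕ} (hn : 0 < n) :
    Real.exp ((Real.log 2 + meanLogSin w) * n - (Real.log 2 - logChord w)) ≤
      ∏ j ∈ Finset.Icc 1 n, ‖1 - circlePt (j * (w / n))‖ := by
  have hn' : (0 : ℝ) < n := by exact_mod_cast hn
  have hw0 : 0 < w := by linarith
  have hnw : n * (w / n) = w := by field_simp
  have h := integral_logChord_le_sum (h := w / n) (by positivity) (n := n) (by rwa [hnw])
    (by rwa [hnw])
  rw [hnw, integral_logChord_eq hw0.ne', div_mul_eq_mul_div, le_div_iff₀ hn', mul_assoc,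
    mul_le_mul_iff_right₀ hw0] at h
  have hprod : ∏ j ∈ Finset.Icc 1 n, ‖1 - circlePt (j * (w / n))‖ =
      Real.exp (∑ j ∈ Finset.Icc 1 n, logChord (j * (w / n))) := by
    rw [Real.exp_sum]
    refine Finset.prod_congr rfl fun j hj => ?_
    have hj := Finset.mem_Icc.1 hj
    have hj1 : (0 : ℝ) < j := by exact_mod_cast hj.1
    have hj2 : (j : ℝ) ≤ n := by exact_mod_cast hj.2
    refine (exp_logChord (by positivity) ?_).symm
    calc (j : ℝ) * (w / n) ≤ n * (w / n) := by gcongr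
      _ = w := hnw
      _ < 1 := hw1
  rw [hprod]
  exact Real.exp_le_exp.2 (by linarith)

/-! ### Coefficients and the sup norm on the circle -/

lemma eval_truncProd_circlePt (s n : ℕ) (θ : ℝ) :
    ‖((truncProd s n).map (Int.castRingHom ℂ)).eval (circlePt θ)‖ =
      (∏ j ∈ Finset.Icc 1 n, ‖1 - circlePt (j * θ)‖) ^ s := by
  rw [truncProd, Polynomial.map_prod, Polynomial.eval_prod, norm_prod, ← Finset.prod_pow]
  refine Finset.prod_congr rfl fun j _ => ?_
  simp [circlePt_pow]

/-- Parseval: one squared coefficient is at most the mean of `|p|²` on the circle. -/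
lemma norm_coeff_le_of_forall_circlePt (p : ℂ[X]) {M : ℝ} (hM : 0 ≤ M)
    (h : ∀ θ : ℝ, ‖p.eval (circlePt θ)‖ ≤ M) (j : ℕ) : ‖p.coeff j‖ ≤ M := by
  by_cases hj : j ∈ p.support
  · have h1 := Finset.single_le_sum (f := fun i => ‖p.coeff i‖ ^ 2) (fun i _ => sq_nonneg _) hj
    rw [p.sum_sq_norm_coeff_eq_circleAverage] at h1
    have h2 : Real.circleAverage (fun z => ‖p.eval z‖ ^ 2) 0 1 ≤ M ^ 2 := by
      refine Real.circleAverage_mono_on_of_le_circle ?_ fun z hz => ?_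
      · refine ContinuousOn.circleIntegrable' ?_
        fun_prop
      · obtain ⟨φ, rfl⟩ : ∃ φ : ℝ, z = Complex.exp (φ * Complex.I) := by
          have : ‖z‖ = 1 := by simpa using hz
          exact ⟨z.arg, by simpa [this] using (Complex.norm_mul_exp_arg_mul_I z).symm⟩
        have := h (φ / (2 * Real.pi))
        rw [circlePt, mul_div_cancel₀ _ (by positivity)] at this
        gcongr
    exact le_of_sq_le_sq (h1.trans h2) hM
  · rw [Polynomial.notMem_support_iff.1 hj, norm_zero]
    exact hM

lemma natDegree_truncProd_le (s n : ℕ) : (truncProd s n).natDegree ≤ truncDeg s n := by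
  have hdeg : ∀ j : ℕ, ((1 : ℤ[X]) - X ^ j).natDegree ≤ j := fun j => by
    refine (natDegree_sub_le _ _).trans ?_
    simp
  have h : (truncProd s n).natDegree ≤ ∑ j ∈ Finset.Icc 1 n, s * j := by
    refine (natDegree_prod_le _ _).trans (Finset.sum_le_sum fun j _ => ?_)
    exact natDegree_pow_le.trans (Nat.mul_le_mul_left s (hdeg j))
  refine h.trans (le_of_eq ?_)
  have hg : ∑ j ∈ Finset.Icc 1 n, s * j = s * ∑ j ∈ Finset.range (n + 1), j := by
    rw [← Finset.mul_sum, sum_Icc_one_eq_sum_range, Finset.sum_range_succ']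
    simp
  have h2 := Finset.sum_range_id_mul_two (n + 1)
  rw [hg, truncDeg]
  refine (Nat.div_eq_of_eq_mul_left two_pos ?_).symm
  rw [mul_assoc s, h2, Nat.add_sub_cancel]
  ring

lemma maxCoeff_le {s n : ℕ} {M : ℝ} (hM : 0 ≤ M)
    (h : ∀ θ : ℝ, ∏ j ∈ Finset.Icc 1 n, ‖1 - circlePt (j * θ)‖ ≤ M) :
    (maxCoeff n s : ℝ) ≤ M ^ s := by
  obtain ⟨j, -, hj⟩ := Finset.exists_mem_eq_sup' (s := Finset.range (truncDeg s n + 1))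
    Finset.nonempty_range_add_one (fun j => |truncCoeff j s n|)
  rw [maxCoeff, hj]
  have := norm_coeff_le_of_forall_circlePt ((truncProd s n).map (Int.castRingHom ℂ))
    (pow_nonneg hM s) (fun θ => by
      rw [eval_truncProd_circlePt]
      have := h θ
      gcongr) j
  rw [coeff_map, eq_intCast, Complex.norm_intCast] at this
  rw [Int.cast_abs]
  exact this

lemma prod_pow_le_maxCoeff (s n : ℕ) (θ : ℝ) :
    (∏ j ∈ Finset.Icc 1 n, ‖1 - circlePt (j * θ)‖) ^ s ≤ (truncDeg s n + 1 : ℕ) * (maxCoeff n s : ℝ) := by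
  rw [← eval_truncProd_circlePt, eval_eq_sum_range' (n := truncDeg s n + 1)]
  · refine (norm_sum_le _ _).trans ?_
    refine (Finset.sum_le_card_nsmul _ _ (maxCoeff n s : ℝ) fun j hj => ?_).trans (by simp)
    rw [norm_mul, norm_pow, norm_circlePt, one_pow, mul_one, coeff_map, eq_intCast,
      Complex.norm_intCast, ← Int.cast_abs]
    exact_mod_cast Finset.le_sup' (fun j => |truncCoeff j s n|) hj
  · exact Nat.lt_succ_of_le ((natDegree_map_le).trans (natDegree_truncProd_le s n))

/-! ### Taylor bounds for `sin`, `cos`, `exp` and `log sin` -/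

lemma nonneg_of_hasDerivAt {f f' : ℝ → ℝ} (hd : ∀ x, HasDerivAt f (f' x) x)
    (hf' : ∀ x, 0 ≤ x → 0 ≤ f' x) (h0 : f 0 = 0) {x : ℝ} (hx : 0 ≤ x) : 0 ≤ f x := by
  have hm : MonotoneOn f (Set.Ici 0) := by
    refine monotoneOn_of_hasDerivWithinAt_nonneg (convex_Ici 0)
      (fun x _ => (hd x).continuousAt.continuousWithinAt)
      (fun x _ => (hd x).hasDerivWithinAt) fun x hx => hf' x ?_
    rw [interior_Ici] at hx
    exact hx.le
  rw [← h0]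
  exact hm Set.self_mem_Ici hx hx

lemma hasDerivAt_polyTerm (c : ℝ) (n : ℕ) (x : ℝ) :
    HasDerivAt (fun x : ℝ => c * x ^ (n + 1)) (c * ((n + 1 : ℕ) * x ^ n)) x := by
  simpa using (hasDerivAt_pow (n + 1) x).const_mul c

lemma cos_le_quartic {x : ℝ} (hx : 0 ≤ x) :
    Real.cos x ≤ 1 - 1 / 2 * x ^ 2 + 1 / 24 * x ^ 4 := by
  have := nonneg_of_hasDerivAt (f := fun x => 1 - 1 / 2 * x ^ 2 + 1 / 24 * x ^ 4 - Real.cos x)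
    (f' := fun x => Real.sin x - (x - x ^ 3 / 6))
    (fun x => ((((hasDerivAt_polyTerm (1 / 2) 1 x).const_sub 1).add
      (hasDerivAt_polyTerm (1 / 24) 3 x)).sub (Real.hasDerivAt_cos x)).congr_deriv
        (by push_cast; ring))
    (fun x hx => sub_nonneg.2 (Real.sin_ge_sub_cube hx)) (by simp) hx
  linarith

lemma sin_le_quintic {x : ℝ} (hx : 0 ≤ x) :
    Real.sin x ≤ x - 1 / 6 * x ^ 3 + 1 / 120 * x ^ 5 := by
  have := nonneg_of_hasDerivAt (f := fun x => x - 1 / 6 * x ^ 3 + 1 / 120 * x ^ 5 - Real.sin x)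
    (f' := fun x => 1 - 1 / 2 * x ^ 2 + 1 / 24 * x ^ 4 - Real.cos x)
    (fun x => ((((hasDerivAt_id x).sub (hasDerivAt_polyTerm (1 / 6) 2 x)).add
      (hasDerivAt_polyTerm (1 / 120) 4 x)).sub (Real.hasDerivAt_sin x)).congr_deriv
        (by push_cast; ring))
    (fun x hx => sub_nonneg.2 (cos_le_quartic hx)) (by simp) hx
  linarith

lemma sextic_le_cos {x : ℝ} (hx : 0 ≤ x) :
    1 - 1 / 2 * x ^ 2 + 1 / 24 * x ^ 4 - 1 / 720 * x ^ 6 ≤ Real.cos x := by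
  have := nonneg_of_hasDerivAt
    (f := fun x => Real.cos x - (1 - 1 / 2 * x ^ 2 + 1 / 24 * x ^ 4 - 1 / 720 * x ^ 6))
    (f' := fun x => x - 1 / 6 * x ^ 3 + 1 / 120 * x ^ 5 - Real.sin x)
    (fun x => ((Real.hasDerivAt_cos x).sub ((((hasDerivAt_polyTerm (1 / 2) 1 x).const_sub 1).add
      (hasDerivAt_polyTerm (1 / 24) 3 x)).sub (hasDerivAt_polyTerm (1 / 720) 5 x))).congr_deriv
        (by push_cast; ring))
    (fun x hx => sub_nonneg.2 (sin_le_quintic hx)) (by simp) hx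
  linarith

lemma septic_le_sin {x : ℝ} (hx : 0 ≤ x) :
    x - 1 / 6 * x ^ 3 + 1 / 120 * x ^ 5 - 1 / 5040 * x ^ 7 ≤ Real.sin x := by
  have := nonneg_of_hasDerivAt
    (f := fun x => Real.sin x - (x - 1 / 6 * x ^ 3 + 1 / 120 * x ^ 5 - 1 / 5040 * x ^ 7))
    (f' := fun x => Real.cos x - (1 - 1 / 2 * x ^ 2 + 1 / 24 * x ^ 4 - 1 / 720 * x ^ 6))
    (fun x => ((Real.hasDerivAt_sin x).sub ((((hasDerivAt_id x).sub
      (hasDerivAt_polyTerm (1 / 6) 2 x)).add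
      (hasDerivAt_polyTerm (1 / 120) 4 x)).sub (hasDerivAt_polyTerm (1 / 5040) 6 x))).congr_deriv
        (by push_cast; ring))
    (fun x hx => sub_nonneg.2 (sextic_le_cos hx)) (by simp) hx
  linarith

lemma hasDerivAt_exp_neg (x : ℝ) : HasDerivAt (fun x => Real.exp (-x)) (-Real.exp (-x)) x :=
  (hasDerivAt_neg x).exp.congr_deriv (by ring)

lemma exp_neg_le_quadratic {u : ℝ} (hu : 0 ≤ u) : Real.exp (-u) ≤ 1 - u + 1 / 2 * u ^ 2 := by
  have := nonneg_of_hasDerivAt (f := fun u => 1 - u + 1 / 2 * u ^ 2 - Real.exp (-u))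
    (f' := fun u => Real.exp (-u) - (-u + 1))
    (fun x => ((((hasDerivAt_id x).const_sub 1).add (hasDerivAt_polyTerm (1 / 2) 1 x)).sub
      (hasDerivAt_exp_neg x)).congr_deriv (by push_cast; ring))
    (fun x _ => sub_nonneg.2 (Real.add_one_le_exp _)) (by simp) hu
  linarith

lemma cubic_le_exp_neg {u : ℝ} (hu : 0 ≤ u) :
    1 - u + 1 / 2 * u ^ 2 - 1 / 6 * u ^ 3 ≤ Real.exp (-u) := by
  have := nonneg_of_hasDerivAt
    (f := fun u => Real.exp (-u) - (1 - u + 1 / 2 * u ^ 2 - 1 / 6 * u ^ 3))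
    (f' := fun u => 1 - u + 1 / 2 * u ^ 2 - Real.exp (-u))
    (fun x => ((hasDerivAt_exp_neg x).sub ((((hasDerivAt_id x).const_sub 1).add
      (hasDerivAt_polyTerm (1 / 2) 1 x)).sub (hasDerivAt_polyTerm (1 / 6) 2 x))).congr_deriv
        (by push_cast; ring))
    (fun x hx => sub_nonneg.2 (exp_neg_le_quadratic hx)) (by simp) hu
  linarith

lemma exp_neg_le_quartic {u : ℝ} (hu : 0 ≤ u) :
    Real.exp (-u) ≤ 1 - u + 1 / 2 * u ^ 2 - 1 / 6 * u ^ 3 + 1 / 24 * u ^ 4 := by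
  have := nonneg_of_hasDerivAt
    (f := fun u => 1 - u + 1 / 2 * u ^ 2 - 1 / 6 * u ^ 3 + 1 / 24 * u ^ 4 - Real.exp (-u))
    (f' := fun u => Real.exp (-u) - (1 - u + 1 / 2 * u ^ 2 - 1 / 6 * u ^ 3))
    (fun x => ((((((hasDerivAt_id x).const_sub 1).add
      (hasDerivAt_polyTerm (1 / 2) 1 x)).sub (hasDerivAt_polyTerm (1 / 6) 2 x)).add
      (hasDerivAt_polyTerm (1 / 24) 3 x)).sub (hasDerivAt_exp_neg x)).congr_deriv
        (by push_cast; ring))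
    (fun x hx => sub_nonneg.2 (cubic_le_exp_neg hx)) (by simp) hu
  linarith

lemma sin_le_mul_exp {x : ℝ} (h0 : 0 ≤ x) (h1 : x ≤ 7 / 10) :
    Real.sin x ≤ x * Real.exp (-(x ^ 2 / 6 + x ^ 4 / 180)) := by
  refine (sin_le_quintic h0).trans ?_
  have h2 := cubic_le_exp_neg (u := x ^ 2 / 6 + x ^ 4 / 180) (by positivity)
  refine le_trans ?_ (mul_le_mul_of_nonneg_left h2 h0)
  have hy : x ^ 2 ≤ 1 / 2 := by nlinarith
  set y := x ^ 2 with hy'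
  have hy0 : 0 ≤ y := sq_nonneg x
  rw [show x ^ 4 = y ^ 2 by rw [hy']; ring,
    show x - 1 / 6 * x ^ 3 + 1 / 120 * x ^ 5 = x * (1 - y / 6 + y ^ 2 / 120) by rw [hy']; ring]
  refine mul_le_mul_of_nonneg_left ?_ h0
  have h3 : 0 ≤ y ^ 3 := by positivity
  have h4 : y ^ 4 ≤ y ^ 3 := pow_le_pow_of_le_one hy0 (by linarith) (by norm_num)
  have h5 : y ^ 5 ≤ y ^ 3 := pow_le_pow_of_le_one hy0 (by linarith) (by norm_num)
  have h6 : y ^ 6 ≤ y ^ 3 := pow_le_pow_of_le_one hy0 (by linarith) (by norm_num)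
  nlinarith

/-- The series is `log (sin x / x) = -x²/6 - x⁴/180 - x⁶/2835 - …`; rounding `2835` down to `2500`
absorbs the tail for `x ≤ 7/10`. -/
lemma mul_exp_le_sin {x : ℝ} (h0 : 0 ≤ x) (h1 : x ≤ 7 / 10) :
    x * Real.exp (-(x ^ 2 / 6 + x ^ 4 / 180 + x ^ 6 / 2500)) ≤ Real.sin x := by
  refine le_trans ?_ (septic_le_sin h0)
  have h2 := exp_neg_le_quartic (u := x ^ 2 / 6 + x ^ 4 / 180 + x ^ 6 / 2500) (by positivity)
  refine (mul_le_mul_of_nonneg_left h2 h0).trans ?_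
  have hy : x ^ 2 ≤ 1 / 2 := by nlinarith
  set y := x ^ 2 with hy'
  have hy0 : 0 ≤ y := sq_nonneg x
  rw [show x ^ 4 = y ^ 2 by rw [hy']; ring, show x ^ 6 = y ^ 3 by rw [hy']; ring,
    show x - 1 / 6 * x ^ 3 + 1 / 120 * x ^ 5 - 1 / 5040 * x ^ 7 =
      x * (1 - y / 6 + y ^ 2 / 120 - y ^ 3 / 5040) by rw [hy']; ring]
  refine mul_le_mul_of_nonneg_left ?_ h0
  have hk : ∀ k, y ^ (k + 4) ≤ y ^ 3 / 2 := fun k => by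
    rw [pow_add, show y ^ 4 = y ^ 3 * y by ring]
    have : y ^ k ≤ 1 := pow_le_one₀ hy0 (by linarith)
    calc y ^ k * (y ^ 3 * y) ≤ 1 * (y ^ 3 * (1 / 2)) := by gcongr
      _ = _ := by ring
  have h3 : 0 ≤ y ^ 3 := by positivity
  have h5 : 0 ≤ y ^ 5 := by positivity
  linarith [hk 0, hk 2, hk 3, hk 4, hk 5, hk 6, hk 7, hk 8]

lemma log_sin_le {x : ℝ} (h0 : 0 < x) (h1 : x ≤ 7 / 10) :
    Real.log (Real.sin x) ≤ Real.log x - (x ^ 2 / 6 + x ^ 4 / 180) := by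
  have h := Real.log_le_log
    (Real.sin_pos_of_pos_of_lt_pi h0 (by linarith [Real.pi_gt_three])) (sin_le_mul_exp h0.le h1)
  rw [Real.log_mul h0.ne' (Real.exp_pos _).ne', Real.log_exp] at h
  linarith

lemma le_log_sin {x : ℝ} (h0 : 0 < x) (h1 : x ≤ 7 / 10) :
    Real.log x - (x ^ 2 / 6 + x ^ 4 / 180 + x ^ 6 / 2500) ≤ Real.log (Real.sin x) := by
  have h := Real.log_le_log (by positivity) (mul_exp_le_sin h0.le h1)
  rw [Real.log_mul h0.ne' (Real.exp_pos _).ne', Real.log_exp] at h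
  linarith

/-- A primitive of `log x - a x² - b x⁴ - c x⁶`. -/
lemma integral_log_sub_poly (a b c x : ℝ) :
    ∫ s in (0 : ℝ)..x, (Real.log s - (a * s ^ 2 + b * s ^ 4 + c * s ^ 6)) =
      x * Real.log x - x - (a * x ^ 3 / 3 + b * x ^ 5 / 5 + c * x ^ 7 / 7) := by
  have hp : ∀ (d : ℝ) (k : ℕ), IntervalIntegrable (fun s => d * s ^ k) MeasureTheory.volume 0 x :=
    fun d k => (by fun_prop : Continuous fun s : ℝ => d * s ^ k).intervalIntegrable 0 x
  rw [intervalIntegral.integral_sub intervalIntegral.intervalIntegrable_log'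
    (((hp a 2).add (hp b 4)).add (hp c 6)),
    intervalIntegral.integral_add ((hp a 2).add (hp b 4)) (hp c 6),
    intervalIntegral.integral_add (hp a 2) (hp b 4)]
  simp only [intervalIntegral.integral_const_mul, integral_pow, integral_log]
  norm_num
  ring

/-! ### Numerical enclosure of `K` -/

lemma log_sin_intervalIntegrable (a b : ℝ) :
    IntervalIntegrable (fun s => Real.log 2 + Real.log (Real.sin s)) MeasureTheory.volume a b :=
  intervalIntegrable_const.add intervalIntegrable_log_sin

/-- Since the integral over `[0, 1]` vanishes, reflection moves the problem to the short interval
`[0, π(1 - w)]`, where the expansion of `log sin` at `0` is accurate. -/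
lemma mul_log_two_add_meanLogSin {w : ℝ} (hw : w ≠ 0) :
    w * (Real.log 2 + meanLogSin w) =
      Real.pi⁻¹ * -∫ s in (0 : ℝ)..(Real.pi * (1 - w)), (Real.log 2 + Real.log (Real.sin s)) := by
  rw [← integral_logChord_eq hw]
  have h1 := intervalIntegral.integral_add_adjacent_intervals
    (logChord_intervalIntegrable 0 w) (logChord_intervalIntegrable w 1)
  have h2 : ∫ t in w..1, logChord t = ∫ t in (0 : ℝ)..(1 - w), logChord t := by
    have := intervalIntegral.integral_comp_sub_left logChord (1 : ℝ) (a := 0) (b := 1 - w)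
    simp only [logChord, sin_pi_mul_one_sub, sub_zero, sub_sub_cancel] at this
    exact this.symm
  have h3 := intervalIntegral.integral_comp_mul_left
    (fun s => Real.log 2 + Real.log (Real.sin s)) Real.pi_ne_zero (a := 0) (b := 1 - w)
  rw [mul_zero, smul_eq_mul] at h3
  rw [integral_logChord_zero_one, h2] at h1
  rw [mul_neg, ← h3]
  exact eq_neg_of_add_eq_zero_left h1

/-- Uses `2 · 0.655885 = (4/3)(1 - 0.0161725)`, a short series and known digits of `log 2` and `log
3`. -/
lemma log_near : |Real.log (2 * 0.655885) - 0.271377370276| ≤ 1 / 10 ^ 8 := by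
  have h := Real.abs_log_sub_add_sum_range_le (x := 0.0161725) (by norm_num [abs_lt]) 4
  have h2 : Real.log (2 * 0.655885) = 2 * Real.log 2 - Real.log 3 + Real.log (1 - 0.0161725) := by
    rw [← Real.log_rpow two_pos, ← Real.log_div (by norm_num) (by norm_num),
      ← Real.log_mul (by norm_num) (by norm_num)]
    norm_num
  rw [h2]
  have h3 := abs_le.1 Real.log_three_near_10
  have h4 := Real.log_two_gt_d9
  have h5 := Real.log_two_lt_d9
  norm_num [Finset.sum_range_succ, abs_le] at h h3 ⊢
  constructor <;> linarith [h.1, h.2, h3.1, h3.2]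

lemma log_sub_poly_mono {s x : ℝ} (h0 : 0 < s) (hsx : s ≤ x) (hx : x ≤ 7 / 10) :
    Real.log s - (s ^ 2 / 6 + s ^ 4 / 180 + s ^ 6 / 2500) ≤
      Real.log x - (x ^ 2 / 6 + x ^ 4 / 180 + x ^ 6 / 2500) := by
  have hx0 : 0 < x := by linarith
  have h1 : Real.log s - Real.log x ≤ s / x - 1 := by
    rw [← Real.log_div h0.ne' hx0.ne']
    exact Real.log_le_sub_one_of_pos (by positivity)
  have h2 : s / x - 1 ≤ -(x - s) := by
    rw [div_sub_one hx0.ne', div_le_iff₀ hx0]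
    nlinarith
  have h3 : x ^ 2 - s ^ 2 ≤ 7 / 5 * (x - s) := by nlinarith
  have hd : 0 ≤ x ^ 2 - s ^ 2 := by nlinarith
  have hx2 : x ^ 2 ≤ 1 / 2 := by nlinarith
  have hs2 : s ^ 2 ≤ 1 / 2 := by nlinarith
  have h4 : x ^ 4 - s ^ 4 ≤ 7 / 5 * (x - s) := by
    have : x ^ 4 - s ^ 4 = (x ^ 2 - s ^ 2) * (x ^ 2 + s ^ 2) := by ring
    rw [this]
    exact (mul_le_of_le_one_right hd (by linarith)).trans h3
  have h6 : x ^ 6 - s ^ 6 ≤ 7 / 5 * (x - s) := by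
    have : x ^ 6 - s ^ 6 = (x ^ 2 - s ^ 2) * ((x ^ 2) ^ 2 + x ^ 2 * s ^ 2 + (s ^ 2) ^ 2) := by ring
    rw [this]
    refine (mul_le_of_le_one_right hd ?_).trans h3
    nlinarith [sq_nonneg x, sq_nonneg s]
  linarith

lemma integral_log_sub_poly_le {x : ℝ} (h0 : 0 < x) (h1 : x ≤ 7 / 10) :
    x * Real.log (2 * x) - x - (x ^ 3 / 18 + x ^ 5 / 900 + x ^ 7 / 17500) ≤
      ∫ s in (0 : ℝ)..x, (Real.log 2 + Real.log (Real.sin s)) := by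
  have h := integral_log_sub_poly (1 / 6) (1 / 180) (1 / 2500) x
  have hi : IntervalIntegrable (fun s => Real.log s - (1 / 6 * s ^ 2 + 1 / 180 * s ^ 4
      + 1 / 2500 * s ^ 6)) MeasureTheory.volume 0 x :=
    intervalIntegral.intervalIntegrable_log'.sub
      ((by fun_prop : Continuous _).intervalIntegrable 0 x)
  have := intervalIntegral.integral_mono_on_of_le_Ioo h0.le
    (intervalIntegrable_const (c := Real.log 2) |>.add hi) (log_sin_intervalIntegrable 0 x)
    fun s hs => by
      have := le_log_sin hs.1 (hs.2.le.trans h1)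
      linarith
  rw [intervalIntegral.integral_add intervalIntegrable_const hi, h] at this
  rw [Real.log_mul two_ne_zero h0.ne']
  refine le_trans (le_of_eq ?_) this
  simp
  ring

lemma integral_log_sin_le {x : ℝ} (h0 : 0 < x) (h1 : x ≤ 7 / 10) :
    ∫ s in (0 : ℝ)..x, (Real.log 2 + Real.log (Real.sin s)) ≤
      x * Real.log (2 * x) - x - (x ^ 3 / 18 + x ^ 5 / 900) := by
  have h := integral_log_sub_poly (1 / 6) (1 / 180) 0 x
  have hi : IntervalIntegrable (fun s => Real.log s - (1 / 6 * s ^ 2 + 1 / 180 * s ^ 4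
      + 0 * s ^ 6)) MeasureTheory.volume 0 x :=
    intervalIntegral.intervalIntegrable_log'.sub
      ((by fun_prop : Continuous _).intervalIntegrable 0 x)
  have := intervalIntegral.integral_mono_on_of_le_Ioo h0.le (log_sin_intervalIntegrable 0 x)
    (intervalIntegrable_const (c := Real.log 2) |>.add hi)
    fun s hs => by
      have := log_sin_le hs.1 (hs.2.le.trans h1)
      linarith
  rw [intervalIntegral.integral_add intervalIntegrable_const hi, h] at this
  rw [Real.log_mul two_ne_zero h0.ne']
  refine this.trans (le_of_eq ?_)
  simp
  ring

/-- A tangent-line type bound for `-∫_0^x log (2 sin s)`, a concave function of `x`. -/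
lemma neg_integral_log_sin_le {x y : ℝ} (hx0 : 0 < x) (hx1 : x ≤ 7 / 10) (hy0 : 0 < y)
    (hy1 : y ≤ Real.pi / 2) :
    -∫ s in (0 : ℝ)..y, (Real.log 2 + Real.log (Real.sin s)) ≤
      -(x * Real.log (2 * x) - x - (x ^ 3 / 18 + x ^ 5 / 900 + x ^ 7 / 17500)) +
        (x - y) * (Real.log (2 * x) - (x ^ 2 / 6 + x ^ 4 / 180 + x ^ 6 / 2500)) := by
  have hl : ∀ {z : ℝ}, 0 < z → Real.log (2 * z) = Real.log 2 + Real.log z := fun hz =>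
    Real.log_mul two_ne_zero hz.ne'
  rcases le_total y x with hyx | hxy
  · have h1 := integral_log_sub_poly_le hy0 (hyx.trans hx1)
    have hi : ∀ a b : ℝ, IntervalIntegrable (fun s => Real.log s - (1 / 6 * s ^ 2 + 1 / 180 * s ^ 4
        + 1 / 2500 * s ^ 6)) MeasureTheory.volume a b := fun a b =>
      intervalIntegral.intervalIntegrable_log'.sub
        ((by fun_prop : Continuous _).intervalIntegrable a b)
    have e := intervalIntegral.integral_add_adjacent_intervals (hi 0 y) (hi y x)
    rw [integral_log_sub_poly, integral_log_sub_poly] at e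
    have h2 := intervalIntegral.integral_mono_on hyx (hi y x) (intervalIntegrable_const
      (c := Real.log x - (x ^ 2 / 6 + x ^ 4 / 180 + x ^ 6 / 2500))) fun s hs => by
        have := log_sub_poly_mono (hy0.trans_le hs.1) hs.2 hx1
        linarith
    rw [intervalIntegral.integral_const, smul_eq_mul] at h2
    rw [hl hx0]
    rw [hl hy0] at h1
    linarith
  · have h1 := integral_log_sub_poly_le hx0 hx1
    have e := intervalIntegral.integral_add_adjacent_intervals (log_sin_intervalIntegrable 0 x)
      (log_sin_intervalIntegrable x y)
    have h2 := intervalIntegral.integral_mono_on hxy (intervalIntegrable_const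
      (c := Real.log 2 + (Real.log x - (x ^ 2 / 6 + x ^ 4 / 180 + x ^ 6 / 2500))))
      (log_sin_intervalIntegrable x y) fun s hs => by
        have h3 := le_log_sin hx0 hx1
        have h4 : Real.log (Real.sin x) ≤ Real.log (Real.sin s) :=
          Real.log_le_log (Real.sin_pos_of_pos_of_lt_pi hx0 (by linarith [Real.pi_gt_three]))
            (Real.sin_le_sin_of_le_of_le_pi_div_two (by linarith [Real.pi_pos])
              (hs.2.trans hy1) hs.1)
        linarith
    rw [intervalIntegral.integral_const, smul_eq_mul] at h2
    rw [hl hx0] at h1 ⊢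
    linarith

lemma log_two_add_meanLogSin_lt {w : ℝ} (hw : 1 / 2 ≤ w) (hw1 : w < 1) :
    Real.log 2 + meanLogSin w < 0.19862 := by
  have hpi := Real.pi_pos
  have hw0 : 0 < w := by linarith
  have hlog := abs_le.1 log_near
  have hpi1 := Real.pi_gt_d6
  have hpi2 := Real.pi_lt_d6
  have hy0 : 0 < Real.pi * (1 - w) := mul_pos hpi (by linarith)
  have hy1 : Real.pi * (1 - w) ≤ Real.pi / 2 := by nlinarith
  -- With `y = π(1 - w)`, stationarity of the mean means `log (2 sin y) = K`; the node `0.655885`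
  -- lies close to that point.
  have h := neg_integral_log_sin_le (x := 0.655885) (by norm_num) (by norm_num) hy0 hy1
  have e := mul_log_two_add_meanLogSin hw0.ne'
  have e2 : Real.pi * w = Real.pi - Real.pi * (1 - w) := by ring
  set y := Real.pi * (1 - w)
  have h5 : |Real.log (2 * 0.655885) -
      ((0.655885 : ℝ) ^ 2 / 6 + 0.655885 ^ 4 / 180 + 0.655885 ^ 6 / 2500) - 0.19862| ≤
        3 / 10 ^ 7 := by
    rw [abs_le]
    norm_num at hlog ⊢
    constructor <;> linarith [hlog.1, hlog.2]
  -- The tangent slope is replaced by `-0.19862`, so that the bound differs from `0.19862 (π - y)`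
  -- by a quantity free of `y`.
  have h6 : (0.655885 - y) * (Real.log (2 * 0.655885) -
      ((0.655885 : ℝ) ^ 2 / 6 + 0.655885 ^ 4 / 180 + 0.655885 ^ 6 / 2500) - 0.19862) ≤
        1 * (3 / 10 ^ 7) := by
    refine (le_abs_self _).trans ?_
    rw [abs_mul]
    refine mul_le_mul ?_ h5 (abs_nonneg _) zero_le_one
    rw [abs_le]
    constructor <;> linarith
  have h7 : Real.pi * w * (Real.log 2 + meanLogSin w) < Real.pi * w * 0.19862 := by
    rw [mul_assoc, e, mul_inv_cancel_left₀ hpi.ne', e2]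
    norm_num at hlog h6 h ⊢
    linarith [hlog.1, hlog.2]
  exact lt_of_mul_lt_mul_left h7 (by positivity)

lemma exists_lt_log_two_add_meanLogSin :
    ∃ w ∈ Set.Ioo (1 / 2 : ℝ) 1, 0.19861 < Real.log 2 + meanLogSin w := by
  have hpi := Real.pi_pos
  have hlog := abs_le.1 log_near
  have hpi1 := Real.pi_gt_d6
  have hpi2 := Real.pi_lt_d6
  have hq : 0.655885 / Real.pi < 1 / 2 := by
    rw [div_lt_iff₀ hpi]
    linarith
  have hq0 : 0 < 0.655885 / Real.pi := by positivity
  have hw0 : 0 < 1 - 0.655885 / Real.pi := by linarith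
  refine ⟨1 - 0.655885 / Real.pi, ⟨by linarith, by linarith⟩, ?_⟩
  have e := mul_log_two_add_meanLogSin hw0.ne'
  have e2 : Real.pi * (1 - (1 - 0.655885 / Real.pi)) = 0.655885 := by field_simp; ring
  have e3 : Real.pi * (1 - 0.655885 / Real.pi) = Real.pi - 0.655885 := by field_simp
  rw [e2] at e
  have h := integral_log_sin_le (x := 0.655885) (by norm_num) (by norm_num)
  refine lt_of_mul_lt_mul_left (a := Real.pi * (1 - 0.655885 / Real.pi)) ?_ (by positivity)
  rw [mul_assoc _ _ (Real.log 2 + _), e, mul_inv_cancel_left₀ hpi.ne', e3]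
  norm_num at hlog h ⊢
  linarith [hlog.1, hlog.2]

/-! ### Attainment of the maximum -/

lemma log_two_add_meanLogSin_one : Real.log 2 + meanLogSin 1 = 0 := by
  rw [← integral_logChord_zero_one, integral_logChord_eq one_ne_zero, one_mul]

lemma log_two_add_meanLogSin_half : Real.log 2 + meanLogSin (1 / 2) = 0 := by
  have := integral_logChord_zero_half
  rw [integral_logChord_eq (by norm_num)] at this
  linarith

lemma continuousOn_meanLogSin : ContinuousOn meanLogSin (Set.Icc (1 / 2) 1) := by
  unfold meanLogSin
  refine ContinuousOn.mul (continuousOn_inv₀.mono fun w hw => ?_) ?_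
  · have := hw.1
    simp only [Set.mem_compl_iff, Set.mem_singleton_iff]
    rintro rfl
    norm_num at this
  · exact (intervalIntegral.continuous_primitive log_sin_pi_intervalIntegrable 0).continuousOn

/-- A maximum exists on the compact interval `[1/2, 1]`; it is not at an endpoint, where the shifted
mean is `0`, while some interior value exceeds `0.19861`. -/
lemma exists_isGreatest_meanLogSin :
    ∃ w ∈ Set.Ioo (1 / 2 : ℝ) 1,
      IsGreatest (meanLogSin '' Set.Ioo (1 / 2 : ℝ) 1) (meanLogSin w) ∧
      0.19861 < Real.log 2 + meanLogSin w ∧ Real.log 2 + meanLogSin w < 0.19862 := by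
  obtain ⟨w, hw, hmax⟩ := isCompact_Icc.exists_isMaxOn ⟨1, by norm_num⟩ continuousOn_meanLogSin
  obtain ⟨v, hv, hlt⟩ := exists_lt_log_two_add_meanLogSin
  have h1 : meanLogSin v ≤ meanLogSin w := hmax (Set.Ioo_subset_Icc_self hv)
  have h2 : w ≠ 1 / 2 := by
    rintro rfl
    linarith [log_two_add_meanLogSin_half]
  have h3 : w ≠ 1 := by
    rintro rfl
    linarith [log_two_add_meanLogSin_one]
  have hw' : w ∈ Set.Ioo (1 / 2 : ℝ) 1 := ⟨lt_of_le_of_ne hw.1 h2.symm, lt_of_le_of_ne hw.2 h3⟩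
  refine ⟨w, hw', ⟨Set.mem_image_of_mem _ hw', ?_⟩, by linarith,
    log_two_add_meanLogSin_lt hw.1 hw'.2⟩
  rintro _ ⟨u, hu, rfl⟩
  exact hmax (Set.Ioo_subset_Icc_self hu)

/-! ### Assembly of the asymptotic formula -/

lemma truncDeg_add_one_le {s n : ℕ} (hs : 1 ≤ s) (hn : 1 ≤ n) :
    truncDeg s n + 1 ≤ 2 * s * n ^ 2 := by
  have h : truncDeg s n ≤ s * n ^ 2 := by
    refine Nat.div_le_of_le_mul ?_
    have : n * (n + 1) * s ≤ n * (n + n) * s := by gcongr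
    exact this.trans (le_of_eq (by ring))
  have : 1 ≤ s * n ^ 2 := Nat.mul_pos hs (pow_pos hn 2)
  linarith

theorem theorem3p10 :
    ∃ m K : ℝ,
      IsGreatest (meanLogSin '' Set.Ioo (1 / 2 : ℝ) 1) m ∧
      K = Real.log 2 + m ∧
      0.19861 < K ∧ K < 0.19862 ∧
      ∀ s : ℕ, 1 ≤ s →
        ∃ E : ℕ → ℝ,
          E =O[Filter.atTop] (fun n : ℕ => Real.log (n : ℝ)) ∧
          ∀ᶠ n : ℕ in Filter.atTop,
            (maxCoeff n s : ℝ) = Real.exp ((s : ℝ) * K * (n : ℝ) + E n) := by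
  obtain ⟨w, hw, hgr, hK1, hK2⟩ := exists_isGreatest_meanLogSin
  refine ⟨meanLogSin w, Real.log 2 + meanLogSin w, hgr, rfl, hK1, hK2, fun s hs => ?_⟩
  set K := Real.log 2 + meanLogSin w with hK
  have hκ : ∀ u ∈ Set.Ioo (1 / 2 : ℝ) 1, Real.log 2 + meanLogSin u ≤ K := fun u hu =>
    add_le_add le_rfl (hgr.2 (Set.mem_image_of_mem _ hu))
  obtain ⟨B, hB⟩ := exists_prod_le hκ (by linarith) (by linarith)
  set c := Real.log 2 - logChord w with hc
  have hc0 : 0 ≤ c := sub_nonneg.2 (logChord_le_log_two (by linarith [hw.1]) hw.2.le)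
  have hs' : (1 : ℝ) ≤ s := by exact_mod_cast hs
  have hlower : ∀ n : ℕ, 1 ≤ n →
      Real.exp (s * (K * n - c) - (Real.log (2 * s) + 2 * Real.log n)) ≤ maxCoeff n s := by
    intro n hn
    have hn' : (0 : ℝ) < n := by exact_mod_cast hn
    have h1 := (pow_le_pow_left₀ (Real.exp_pos _).le (exp_le_prod hw.1 hw.2 hn) s).trans
      (prod_pow_le_maxCoeff s n (w / n))
    have hdeg : ((truncDeg s n + 1 : ℕ) : ℝ) ≤ 2 * s * n ^ 2 := by
      exact_mod_cast truncDeg_add_one_le hs hn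
    have hdpos : (0 : ℝ) < (truncDeg s n + 1 : ℕ) := by positivity
    have hM : (0 : ℝ) < maxCoeff n s :=
      pos_of_mul_pos_right ((pow_pos (Real.exp_pos _) s).trans_le h1) hdpos.le
    rw [Real.exp_sub, Real.exp_add, two_mul (Real.log n), Real.exp_add, Real.exp_log hn',
      Real.exp_log (by positivity), div_le_iff₀ (by positivity), Real.exp_nat_mul]
    calc _ ≤ _ := h1
      _ ≤ 2 * s * n ^ 2 * (maxCoeff n s : ℝ) := by gcongr
      _ = _ := by ring
  have hupper : ∀ n : ℕ, 2 ≤ n →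
      (maxCoeff n s : ℝ) ≤ Real.exp (s * (K * n + (B + 4 * Real.log (2 * n)))) := by
    intro n hn
    rw [Real.exp_nat_mul]
    exact maxCoeff_le (Real.exp_pos _).le fun θ => hB n θ hn
  have hpos : ∀ n : ℕ, 1 ≤ n → (0 : ℝ) < maxCoeff n s := fun n hn =>
    (Real.exp_pos _).trans_le (hlower n hn)
  -- The error is the exact discrepancy, so the identity only needs `maxCoeff n s` to be positive,
  -- which the lower bound supplies.
  refine ⟨fun n => Real.log (maxCoeff n s) - s * K * n, ?_, ?_⟩
  · refine Asymptotics.IsBigO.of_bound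
      (s * (|B| + 4 * Real.log 2 + 4) + s * c + (Real.log (2 * s) + 2)) ?_
    -- From `n = 3` on `log n ≥ 1`, so constants are absorbed into multiples of `log n`.
    filter_upwards [Filter.eventually_ge_atTop 3] with n hn
    have hn3 : (3 : ℝ) ≤ n := by exact_mod_cast hn
    have hlogn : 1 ≤ Real.log n := by
      have := Real.log_le_log (by norm_num) hn3
      linarith [Real.log_three_gt_d9]
    have hl := Real.log_le_log (Real.exp_pos _) (hlower n (by omega))
    have hu := Real.log_le_log (hpos n (by omega)) (hupper n (by omega))
    rw [Real.log_exp] at hl hu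
    rw [Real.log_mul two_ne_zero (by positivity)] at hu
    have hls : 0 ≤ Real.log (2 * s) := Real.log_nonneg (by linarith)
    have hl2 : 0 ≤ Real.log 2 := Real.log_nonneg (by norm_num)
    have hB' : B ≤ |B| := le_abs_self B
    rw [Real.norm_eq_abs, Real.norm_eq_abs, abs_of_nonneg (by linarith : 0 ≤ Real.log n)]
    have g1 : s * (|B| + 4 * Real.log 2) ≤ s * (|B| + 4 * Real.log 2) * Real.log n :=
      le_mul_of_one_le_right (by positivity) hlogn
    have g2 : s * c ≤ s * c * Real.log n := le_mul_of_one_le_right (by positivity) hlogn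
    have g3 : Real.log (2 * s) ≤ Real.log (2 * s) * Real.log n := le_mul_of_one_le_right hls hlogn
    have g4 : s * B ≤ s * |B| := by gcongr
    have g5 : 0 ≤ s * (|B| + 4 * Real.log 2) := by positivity
    have g6 : 0 ≤ s * c := by positivity
    have g7 : 0 ≤ s * Real.log n := by positivity
    rw [abs_le]
    constructor <;> linarith
  · filter_upwards [Filter.eventually_ge_atTop 1] with n hn
    rw [add_sub_cancel, Real.exp_log (hpos n hn)]
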